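/- Let $\Bbbk$ be a commutative ring and let $I\subseteq\Bbbk$ be the image of $\mathbb Z$. Let $\lambda=\sum_{i\in I}\lambda_i\omega_i$ be a formal combination with $\lambda_i\in\mathbb N$, finitely many of them nonzero and $\lambda\neq 0$, and put $d=\sum_i\lambda_i$ (the level). **The category $\mathcal H^\lambda$.** Consider the strict $\Bbbk$-linear monoidal category whose objects are the words $Q_\epsilon=Q_{\epsilon_1}\cdots Q_{\epsilon_k}$, $\epsilon_i\in\{+,-\}$ (with $\mathbf 1=Q_\varnothing$), and whose morphisms $Q_\epsilon\to Q_{\epsilon'}$ are the $\Bbbk$-linear combinations of oriented planar string diagrams in $\mathbb R\times[0,1]$ (read from bottom to top, $+$ = upward, $-$ = downward), built from cups, caps, crossings of two strands, and dots on strands, modulo planar isotopy (dots move freely along strands, but not through crossings), and modulo the local relations below. Write $x$ for the dot on an upward strand, $s\colon Q_+Q_+\to Q_+Q_+$ for the crossing of two upward strands, $t\colon Q_+Q_-\to Q_-Q_+$ and $t'\colon Q_-Q_+\to Q_+Q_-$ for the crossings in which both strands run to the right, respectively to the left (the rotations of $s$ by a right angle), $\eta\colon\mathbf 1\to Q_-Q_+$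 and $\varepsilon\colon Q_-Q_+\to\mathbf 1$ for the cup and the cap with these endpoints, $1_\pm$ for the identity of $Q_\pm$, and $b_n=\varepsilon\circ(1_-\otimes x^n)\circ\eta$ for the counterclockwise circle with $n$ dots. Put $c_s=(-1)^s\det(b_{d+j-i})_{1\le i,j\le s}$ for $0\le s\le d$ (so $c_0=1$), and define the dual dots $x_j^\vee=\sum_{i=j}^{d-1}x^{i-j}\otimes c_{d-1-i}\colon Q_+\to Q_+$ for $0\le j\le d-1$. The local relations are 1. $(s\otimes 1_+)(1_+\otimes s)(s\otimes 1_+)=(1_+\otimes s)(s\otimes 1_+)(1_+\otimes s)$ and $s^2=1_+\otimes 1_+$; 2. $s(x\otimes 1_+)-(1_+\otimes x)s=1_+\otimes 1_+=(x\otimes 1_+)s-s(1_+\otimes x)$; 3. $1_-\otimes 1_+=t\,t'+\sum_{j=0}^{d-1}(1_-\otimes x^j)\,\eta\,\varepsilon\,(1_-\otimes x_j^\vee)$ (the dual-dot relation) and $t'\,t=1_+\otimes 1_-$; 4. $b_n=0$ for $n<d-1$, $b_{d-1}=1$, and $b_d=\sum_{i\in I}i\lambda_i$; 5. the left curl vanishes: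 $(\varepsilon\otimes 1_+)(1_-\otimes s)(\eta\otimes 1_+)=0$. Let $\widetilde{\mathcal H}^\lambda$ be the additive category obtained by adjoining formal finite direct sums of the objects $Q_\epsilon$, and let $\mathcal H^\lambda$ be the idempotent completion of $\widetilde{\mathcal H}^\lambda$. **Proposition.** Fix $j\in I$ and define $\mu=\sum_{i\in I}\mu_i\omega_i$ by $\mu_i=\lambda_{i-j}$ for $i\in I$. Then the categories $\mathcal H^\lambda$ and $\mathcal H^\mu$ are isomorphic. More precisely, the substitution on diagrams which is $\Bbbk$-linear, compatible with composition and juxtaposition, is the identity on the words $Q_\epsilon$, replaces each dot $x$ by $x-j\,1_+$, and fixes all cups, caps and crossings, carries every defining relation for $\lambda$ (planar isotopy and the local relations 1–5, including the dual-dot relation) to a relation that holds for $\mu$. It therefore induces a strict monoidal $\Bbbk$-linear functor, given by the same formulas, between the categories of the words $Q_\epsilon$ for $\lambda$ and for $\mu$, and the extension of this functor to direct sums and idempotents is an isomorphism of categories $\mathcal H^\lambda\to\mathcal H^\mu$. -/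

import Mathlib

open CategoryTheory MonoidalCategory

universe u

noncomputable section

namespace Heis

/-! ### Strict `k`-linear monoidal categories presented by generators and relations -/

/-- The two generating objects: `plus` is `Q₊` (an upward strand), `minus` is `Q₋` (a downward
strand). -/
inductive Sign
  | plus
  | minus

open Sign

/-- The elementary oriented dotted diagrams.  Diagrams are read from bottom (source) to top
(target). -/
inductive Gen : List Sign → List Sign → Type
  /-- a dot on an upward strand -/
  | dot : Gen [plus] [plus]
  /-- a crossing of two upward strands -/
  | cross : Gen [plus, plus] [plus, plus]
  /-- the cup whose left end points down and whose right end points up -/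
  | cupMP : Gen [] [minus, plus]
  /-- the cap which is entered from below on the right and left downwards on the left -/
  | capMP : Gen [minus, plus] []
  /-- the cup whose left end points up and whose right end points down -/
  | cupPM : Gen [] [plus, minus]
  /-- the cap which is entered from below on the left and left downwards on the right -/
  | capPM : Gen [plus, minus] []

/-- Formal `k`-linear combinations of formal compositions and juxtapositions of elementary
diagrams. -/
inductive Raw (k : Type u) : List Sign → List Sign → Type u
  | gen {X Y : List Sign} (g : Gen X Y) : Raw k X Y
  | id (X : List Sign) : Raw k X X
  | comp {X Y Z : List Sign} (f : Raw k X Y) (g : Raw k Y Z) : Raw k X Z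
  | tensor {X Y X' Y' : List Sign} (f : Raw k X Y) (g : Raw k X' Y') : Raw k (X ++ X') (Y ++ Y')
  | zero (X Y : List Sign) : Raw k X Y
  | add {X Y : List Sign} (f g : Raw k X Y) : Raw k X Y
  | smul {X Y : List Sign} (a : k) (f : Raw k X Y) : Raw k X Y

/-- The identity of a word, seen as a morphism between two words which are equal. -/
def Raw.ofEq {k : Type u} {X Y : List Sign} (h : X = Y) : Raw k X Y := h ▸ Raw.id X

/-- A family of relations to be imposed. -/
abbrev PreRel (k : Type u) : Type u := ∀ ⦃X Y : List Sign⦄, Raw k X Y → Raw k X Y → Prop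

/-- The smallest equivalence relation which contains `L`, is compatible with composition,
juxtaposition and linear combinations, and makes the quotient a strict `k`-linear monoidal
category. -/
inductive Rel {k : Type u} [CommRing k] (L : PreRel k) :
    ∀ {X Y : List Sign}, Raw k X Y → Raw k X Y → Prop
  | of {X Y : List Sign} {f g : Raw k X Y} : L f g → Rel L f g
  -- equivalence relation and congruence
  | refl {X Y : List Sign} (f : Raw k X Y) : Rel L f f
  | symm {X Y : List Sign} {f g : Raw k X Y} : Rel L f g → Rel L g f
  | trans {X Y : List Sign} {f g h : Raw k X Y} : Rel L f g → Rel L g h → Rel L f h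
  | comp {X Y Z : List Sign} {f f' : Raw k X Y} {g g' : Raw k Y Z} :
      Rel L f f' → Rel L g g' → Rel L (f.comp g) (f'.comp g')
  | tensor {X Y X' Y' : List Sign} {f f' : Raw k X Y} {g g' : Raw k X' Y'} :
      Rel L f f' → Rel L g g' → Rel L (f.tensor g) (f'.tensor g')
  | add {X Y : List Sign} {f f' g g' : Raw k X Y} :
      Rel L f f' → Rel L g g' → Rel L (f.add g) (f'.add g')
  | smul {X Y : List Sign} (a : k) {f f' : Raw k X Y} : Rel L f f' → Rel L (f.smul a) (f'.smul a)
  -- category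
  | id_comp {X Y : List Sign} (f : Raw k X Y) : Rel L ((Raw.id X).comp f) f
  | comp_id {X Y : List Sign} (f : Raw k X Y) : Rel L (f.comp (Raw.id Y)) f
  | assoc {W X Y Z : List Sign} (f : Raw k W X) (g : Raw k X Y) (h : Raw k Y Z) :
      Rel L ((f.comp g).comp h) (f.comp (g.comp h))
  -- `k`-modules of morphisms
  | add_assoc {X Y : List Sign} (f g h : Raw k X Y) : Rel L ((f.add g).add h) (f.add (g.add h))
  | add_comm {X Y : List Sign} (f g : Raw k X Y) : Rel L (f.add g) (g.add f)
  | zero_add {X Y : List Sign} (f : Raw k X Y) : Rel L ((Raw.zero X Y).add f) f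
  | smul_add {X Y : List Sign} (a : k) (f g : Raw k X Y) :
      Rel L ((f.add g).smul a) ((f.smul a).add (g.smul a))
  | add_smul {X Y : List Sign} (a b : k) (f : Raw k X Y) :
      Rel L (f.smul (a + b)) ((f.smul a).add (f.smul b))
  | mul_smul {X Y : List Sign} (a b : k) (f : Raw k X Y) :
      Rel L (f.smul (a * b)) ((f.smul b).smul a)
  | one_smul {X Y : List Sign} (f : Raw k X Y) : Rel L (f.smul 1) f
  | zero_smul {X Y : List Sign} (f : Raw k X Y) : Rel L (f.smul 0) (Raw.zero X Y)
  -- bilinearity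
  | add_comp {X Y Z : List Sign} (f f' : Raw k X Y) (g : Raw k Y Z) :
      Rel L ((f.add f').comp g) ((f.comp g).add (f'.comp g))
  | comp_add {X Y Z : List Sign} (f : Raw k X Y) (g g' : Raw k Y Z) :
      Rel L (f.comp (g.add g')) ((f.comp g).add (f.comp g'))
  | smul_comp {X Y Z : List Sign} (a : k) (f : Raw k X Y) (g : Raw k Y Z) :
      Rel L ((f.smul a).comp g) ((f.comp g).smul a)
  | comp_smul {X Y Z : List Sign} (a : k) (f : Raw k X Y) (g : Raw k Y Z) :
      Rel L (f.comp (g.smul a)) ((f.comp g).smul a)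
  | add_tensor {X Y X' Y' : List Sign} (f f' : Raw k X Y) (g : Raw k X' Y') :
      Rel L ((f.add f').tensor g) ((f.tensor g).add (f'.tensor g))
  | tensor_add {X Y X' Y' : List Sign} (f : Raw k X Y) (g g' : Raw k X' Y') :
      Rel L (f.tensor (g.add g')) ((f.tensor g).add (f.tensor g'))
  | smul_tensor {X Y X' Y' : List Sign} (a : k) (f : Raw k X Y) (g : Raw k X' Y') :
      Rel L ((f.smul a).tensor g) ((f.tensor g).smul a)
  | tensor_smul {X Y X' Y' : List Sign} (a : k) (f : Raw k X Y) (g : Raw k X' Y') :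
      Rel L (f.tensor (g.smul a)) ((f.tensor g).smul a)
  -- strict monoidal structure
  | id_tensor_id (X Y : List Sign) : Rel L ((Raw.id X).tensor (Raw.id Y)) (Raw.id (X ++ Y))
  | tensor_comp {X Y Z X' Y' Z' : List Sign} (f : Raw k X Y) (g : Raw k Y Z)
      (f' : Raw k X' Y') (g' : Raw k Y' Z') :
      Rel L ((f.tensor f').comp (g.tensor g')) ((f.comp g).tensor (f'.comp g'))
  | id_tensor {X Y : List Sign} (f : Raw k X Y) : Rel L ((Raw.id []).tensor f) f
  | tensor_id {X Y : List Sign} (f : Raw k X Y) :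
      Rel L ((f.tensor (Raw.id [])).comp (Raw.ofEq (List.append_nil Y)))
        ((Raw.ofEq (List.append_nil X)).comp f)
  | tensor_assoc {X Y X' Y' X'' Y'' : List Sign} (f : Raw k X Y) (g : Raw k X' Y')
      (h : Raw k X'' Y'') :
      Rel L (((f.tensor g).tensor h).comp (Raw.ofEq (List.append_assoc Y Y' Y'')))
        ((Raw.ofEq (List.append_assoc X X' X'')).comp (f.tensor (g.tensor h)))

/-- The objects `Q_ε` of the strict `k`-linear monoidal category generated by the elementary
diagrams subject to the relations `L`: words in the two signs. -/
@[ext]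
structure Pres {k : Type u} (L : PreRel k) where
  /-- the sign sequence `ε` -/
  word : List Sign

variable {k : Type u} [CommRing k]

namespace Pres

variable {L : PreRel k}

/-- The class of a formal linear combination of diagrams. -/
def cls (L : PreRel k) {X Y : List Sign} (f : Raw k X Y) : Quot (Rel L (X := X) (Y := Y)) :=
  Quot.mk _ f

theorem sound {X Y : List Sign} {f g : Raw k X Y} (h : Rel L f g) : cls L f = cls L g :=
  Quot.sound h

instance : Category.{u, 0} (Pres L) where
  Hom X Y := Quot (Rel L (X := X.word) (Y := Y.word))
  id X := cls L (Raw.id X.word)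
  comp f g := Quot.map₂ Raw.comp (fun _ _ _ h => .comp (.refl _) h)
    (fun _ _ _ h => .comp h (.refl _)) f g
  id_comp := by rintro _ _ ⟨f⟩; exact sound (.id_comp f)
  comp_id := by rintro _ _ ⟨f⟩; exact sound (.comp_id f)
  assoc := by rintro _ _ _ _ ⟨f⟩ ⟨g⟩ ⟨h⟩; exact sound (.assoc f g h)

/-- The class of a formal linear combination of diagrams, as a morphism. -/
def hom (L : PreRel k) {X Y : List Sign} (f : Raw k X Y) :
    (⟨X⟩ : Pres L) ⟶ (⟨Y⟩ : Pres L) := cls L f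

instance (X Y : Pres L) : Zero (X ⟶ Y) where
  zero := cls L (Raw.zero X.word Y.word)

instance (X Y : Pres L) : Add (X ⟶ Y) where
  add f g := Quot.map₂ Raw.add (fun _ _ _ h => .add (.refl _) h)
    (fun _ _ _ h => .add h (.refl _)) f g

instance (X Y : Pres L) : Neg (X ⟶ Y) where
  neg f := Quot.map (Raw.smul (-1)) (fun _ _ h => .smul _ h) f

instance (X Y : Pres L) : AddCommGroup (X ⟶ Y) where
  add_assoc := by rintro ⟨f⟩ ⟨g⟩ ⟨h⟩; exact sound (.add_assoc f g h)
  add_comm := by rintro ⟨f⟩ ⟨g⟩; exact sound (.add_comm f g)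
  zero_add := by rintro ⟨f⟩; exact sound (.zero_add f)
  add_zero := by rintro ⟨f⟩; exact sound (.trans (.add_comm _ _) (.zero_add f))
  neg_add_cancel := by
    rintro ⟨f⟩
    refine sound (.trans (.add (.refl _) (.symm (.one_smul f))) (.trans (.symm (.add_smul _ _ _)) ?_))
    rw [neg_add_cancel]
    exact .zero_smul f
  nsmul := nsmulRec
  zsmul := zsmulRec

instance : Preadditive (Pres L) where
  add_comp := by rintro _ _ _ ⟨f⟩ ⟨f'⟩ ⟨g⟩; exact sound (.add_comp f f' g)
  comp_add := by rintro _ _ _ ⟨f⟩ ⟨g⟩ ⟨g'⟩; exact sound (.comp_add f g g')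

instance (X Y : Pres L) : SMul k (X ⟶ Y) where
  smul a f := Quot.map (Raw.smul a) (fun _ _ h => .smul a h) f

instance (X Y : Pres L) : Module k (X ⟶ Y) where
  one_smul := by rintro ⟨f⟩; exact sound (.one_smul f)
  mul_smul := by rintro a b ⟨f⟩; exact sound (.mul_smul a b f)
  smul_add := by rintro a ⟨f⟩ ⟨g⟩; exact sound (.smul_add a f g)
  add_smul := by rintro a b ⟨f⟩; exact sound (.add_smul a b f)
  zero_smul := by rintro ⟨f⟩; exact sound (.zero_smul f)
  smul_zero := fun a => sound (.trans (.smul a (.symm (.zero_smul (Raw.zero _ _))))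
    (.trans (.symm (.mul_smul a 0 _)) (by rw [mul_zero]; exact .zero_smul _)))

instance : Linear k (Pres L) where
  smul_comp := by rintro _ _ _ a ⟨f⟩ ⟨g⟩; exact sound (.smul_comp a f g)
  comp_smul := by rintro _ _ _ ⟨f⟩ a ⟨g⟩; exact sound (.comp_smul a f g)

theorem hom_ofEq {X Y : List Sign} (h : X = Y) :
    hom L (Raw.ofEq h) = eqToHom (congrArg Pres.mk h) := by
  subst h; rfl

/-- Horizontal juxtaposition. -/
def tensorHom {X Y X' Y' : Pres L} (f : X ⟶ Y) (g : X' ⟶ Y') :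
    (⟨X.word ++ X'.word⟩ : Pres L) ⟶ ⟨Y.word ++ Y'.word⟩ :=
  Quot.map₂ Raw.tensor (fun _ _ _ h => .tensor (.refl _) h)
    (fun _ _ _ h => .tensor h (.refl _)) f g

instance : MonoidalCategoryStruct (Pres L) where
  tensorObj X Y := ⟨X.word ++ Y.word⟩
  tensorUnit := ⟨[]⟩
  tensorHom f g := tensorHom f g
  whiskerLeft X _ _ f := tensorHom (𝟙 X) f
  whiskerRight f Y := tensorHom f (𝟙 Y)
  associator X Y Z := eqToIso (congrArg Pres.mk (List.append_assoc X.word Y.word Z.word))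
  leftUnitor _ := eqToIso rfl
  rightUnitor X := eqToIso (congrArg Pres.mk (List.append_nil X.word))

theorem id_tensorHom_id (X Y : Pres L) : 𝟙 X ⊗ₘ 𝟙 Y = 𝟙 (X ⊗ Y) :=
  sound (.id_tensor_id X.word Y.word)

theorem eqToHom_tensor_id {X Y : Pres L} (h : X = Y) (Z : Pres L) :
    eqToHom h ⊗ₘ 𝟙 Z = eqToHom (congrArg (· ⊗ Z) h) := by
  subst h; exact id_tensorHom_id _ _

theorem id_tensor_eqToHom {X Y : Pres L} (h : X = Y) (Z : Pres L) :
    𝟙 Z ⊗ₘ eqToHom h = eqToHom (congrArg (Z ⊗ ·) h) := by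
  subst h; exact id_tensorHom_id _ _

theorem associator_hom (X Y Z : Pres L) : (α_ X Y Z).hom =
    eqToHom (congrArg Pres.mk (List.append_assoc X.word Y.word Z.word)) := rfl

theorem leftUnitor_hom (X : Pres L) : (λ_ X).hom = 𝟙 X := rfl

theorem rightUnitor_hom (X : Pres L) : (ρ_ X).hom =
    eqToHom (congrArg Pres.mk (List.append_nil X.word)) := rfl

/-- Juxtaposition makes `Pres L` a monoidal category; it is strict, in that the associators and
unitors are the identities given by equality of words. -/
instance : MonoidalCategory (Pres L) := MonoidalCategory.ofTensorHom
  (id_tensorHom_id := id_tensorHom_id)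
  (id_tensorHom := fun _ _ _ _ => rfl)
  (tensorHom_id := fun _ _ => rfl)
  (tensorHom_comp_tensorHom := by
    rintro _ _ _ _ _ _ ⟨f⟩ ⟨f'⟩ ⟨g⟩ ⟨g'⟩; exact sound (.tensor_comp f g f' g'))
  (associator_naturality := by
    rintro _ _ _ _ _ _ ⟨f⟩ ⟨g⟩ ⟨h⟩
    rw [associator_hom, associator_hom, ← hom_ofEq (List.append_assoc _ _ _),
      ← hom_ofEq (List.append_assoc _ _ _)]
    exact sound (.tensor_assoc f g h))
  (leftUnitor_naturality := by
    rintro _ _ ⟨f⟩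
    rw [leftUnitor_hom, leftUnitor_hom]
    exact sound (.trans (.comp_id _) (.trans (.id_tensor f) (.symm (.id_comp f)))))
  (rightUnitor_naturality := by
    rintro _ _ ⟨f⟩
    rw [rightUnitor_hom, rightUnitor_hom, ← hom_ofEq (List.append_nil _),
      ← hom_ofEq (List.append_nil _)]
    exact sound (.tensor_id f))
  (pentagon := fun W X Y Z => by
    simp only [associator_hom]
    erw [eqToHom_tensor_id, id_tensor_eqToHom]
    simp)
  (triangle := fun X Y => by
    rw [associator_hom, leftUnitor_hom, rightUnitor_hom]
    erw [eqToHom_tensor_id, eqToHom_tensor_id]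
    · simp
    · rfl)

instance : MonoidalPreadditive (Pres L) where
  whiskerLeft_add := by rintro _ _ _ ⟨f⟩ ⟨g⟩; exact sound (.tensor_add _ f g)
  add_whiskerRight := by rintro _ _ _ ⟨f⟩ ⟨g⟩; exact sound (.add_tensor f g _)
  whiskerLeft_zero := fun {X Y Z} => sound
    (.trans (.tensor (.refl _) (.symm (.zero_smul (Raw.zero Y.word Z.word))))
      (.trans (.tensor_smul 0 _ _) (.zero_smul _)))
  zero_whiskerRight := fun {X Y Z} => sound
    (.trans (.tensor (.symm (.zero_smul (Raw.zero Y.word Z.word))) (.refl _))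
      (.trans (.smul_tensor 0 _ _) (.zero_smul _)))

instance : MonoidalLinear k (Pres L) where
  whiskerLeft_smul := by rintro _ _ _ a ⟨f⟩; exact sound (.tensor_smul a _ f)
  smul_whiskerRight := by rintro a _ _ ⟨f⟩ _; exact sound (.smul_tensor a f _)

end Pres

/-- In a preadditive monoidal category, the endomorphisms of the unit object form a commutative
ring. -/
abbrev endUnitCommRing (C : Type*) [Category* C] [Preadditive C] [MonoidalCategory C] :
    CommRing (End (𝟙_ C)) where
  __ := (inferInstance : Ring (End (𝟙_ C)))
  mul_comm f g := by
    have h : ∀ f g : 𝟙_ C ⟶ 𝟙_ C, f ≫ g = (λ_ _).inv ≫ (f ⊗ₘ g) ≫ (λ_ _).hom := by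
      intro f g
      rw [MonoidalCategory.tensorHom_def]
      simp [unitors_equal, unitors_inv_equal]
    have h' : ∀ f g : 𝟙_ C ⟶ 𝟙_ C, g ≫ f = (λ_ _).inv ≫ (f ⊗ₘ g) ≫ (λ_ _).hom := by
      intro f g
      rw [MonoidalCategory.tensorHom_def']
      simp [unitors_equal, unitors_inv_equal]
    exact (h' f g).trans (h f g).symm

/-! ### Elementary diagrams and the local pictures built from them -/

section Diagrams

variable (L : PreRel k)

/-- The object `Q₊`. -/
def Qp : Pres L := ⟨[plus]⟩

/-- The object `Q₋`. -/
def Qm : Pres L := ⟨[minus]⟩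

/-- An upward strand with one dot. -/
def dot : Qp L ⟶ Qp L := Pres.hom L (.gen .dot)

/-- The crossing of two upward strands. -/
def cross : Qp L ⊗ Qp L ⟶ Qp L ⊗ Qp L := Pres.hom L (.gen .cross)

/-- The cup from which `Q₋ Q₊` emerges. -/
def cupMP : 𝟙_ (Pres L) ⟶ Qm L ⊗ Qp L := Pres.hom L (.gen .cupMP)

/-- The cap which closes `Q₋ Q₊`. -/
def capMP : Qm L ⊗ Qp L ⟶ 𝟙_ (Pres L) := Pres.hom L (.gen .capMP)

/-- The cup from which `Q₊ Q₋` emerges. -/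
def cupPM : 𝟙_ (Pres L) ⟶ Qp L ⊗ Qm L := Pres.hom L (.gen .cupPM)

/-- The cap which closes `Q₊ Q₋`. -/
def capPM : Qp L ⊗ Qm L ⟶ 𝟙_ (Pres L) := Pres.hom L (.gen .capPM)

/-- An upward strand with `n` dots. -/
def dots : ℕ → (Qp L ⟶ Qp L)
  | 0 => 𝟙 _
  | n + 1 => dots n ≫ dot L

/-- The crossing rotated clockwise by a right angle: both strands run to the right. -/
def crossRight : Qp L ⊗ Qm L ⟶ Qm L ⊗ Qp L :=
  𝟙 _ ⊗≫ cupMP L ▷ (Qp L ⊗ Qm L) ⊗≫ Qm L ◁ cross L ▷ Qm L ⊗≫ (Qm L ⊗ Qp L) ◁ capPM L ⊗≫ 𝟙 _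

/-- The crossing rotated counterclockwise by a right angle: both strands run to the left. -/
def crossLeft : Qm L ⊗ Qp L ⟶ Qp L ⊗ Qm L :=
  𝟙 _ ⊗≫ (Qm L ⊗ Qp L) ◁ cupPM L ⊗≫ Qm L ◁ cross L ▷ Qm L ⊗≫ capMP L ▷ (Qp L ⊗ Qm L) ⊗≫ 𝟙 _

/-- The counterclockwise circle with `n` dots. -/
def bubble (n : ℕ) : End (𝟙_ (Pres L)) := cupMP L ≫ Qm L ◁ dots L n ≫ capMP L

/-- The endomorphism `c_s` of the unit object, for level `d` and `0 ≤ s ≤ d`. -/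
def cc (d s : ℕ) : End (𝟙_ (Pres L)) :=
  letI := endUnitCommRing (Pres L)
  (-1) ^ s * Matrix.det (Matrix.of fun i j : Fin s => bubble L (d + (j : ℕ) - (i : ℕ)))

/-- The dual dot `j^∨` on an upward strand, for level `d` and `0 ≤ j < d`: the bubbles in
`c_{d-1-i}` are placed to the right of the strand. -/
def dualDot (d j : ℕ) : Qp L ⟶ Qp L :=
  ∑ i ∈ Finset.Ico j d, (ρ_ (Qp L)).inv ≫ (dots L (i - j) ⊗ₘ cc L d (d - 1 - i)) ≫ (ρ_ (Qp L)).hom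

end Diagrams

/-! ### Diagrams, and the local relations -/

variable (k) in
/-- The set `I`: the image of `ℤ` in `k`. -/
abbrev IntImage : Subring k := (Int.castRingHom k).range

/-- The level `d` of the dominant weight `∑ i, λ_i ω_i`. -/
def level (lam : IntImage k →₀ ℕ) : ℕ := lam.sum fun _ n => n

variable (k) in
/-- No relations. -/
def noRel : PreRel k := fun _ _ _ _ => False

variable (k) in
/-- Free linear combinations of formal diagrams, subject only to the laws of a strict `k`-linear
monoidal category. -/
abbrev Free : Type := Pres (noRel k)

/-- The relations defining the category: planar isotopy, and the local relations for the
dominant weight `lam`. -/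
inductive LocalRel (lam : IntImage k →₀ ℕ) : ∀ {X Y : Free k}, (X ⟶ Y) → (X ⟶ Y) → Prop
  -- planar isotopy: straightening of cups and caps
  | zigzag₁ : LocalRel lam
      (𝟙 _ ⊗≫ cupPM _ ▷ Qp _ ⊗≫ Qp _ ◁ capMP _ ⊗≫ 𝟙 _) (𝟙 (Qp _))
  | zigzag₂ : LocalRel lam
      (𝟙 _ ⊗≫ Qp _ ◁ cupMP _ ⊗≫ capPM _ ▷ Qp _ ⊗≫ 𝟙 _) (𝟙 (Qp _))
  | zigzag₃ : LocalRel lam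
      (𝟙 _ ⊗≫ cupMP _ ▷ Qm _ ⊗≫ Qm _ ◁ capPM _ ⊗≫ 𝟙 _) (𝟙 (Qm _))
  | zigzag₄ : LocalRel lam
      (𝟙 _ ⊗≫ Qm _ ◁ cupPM _ ⊗≫ capMP _ ▷ Qm _ ⊗≫ 𝟙 _) (𝟙 (Qm _))
  -- planar isotopy: the two rotations of a dot (a crossing) by two right angles agree
  | dot_rotate : LocalRel lam (X := Qm _) (Y := Qm _)
      (𝟙 _ ⊗≫ cupMP _ ▷ Qm _ ⊗≫ Qm _ ◁ dot _ ▷ Qm _ ⊗≫ Qm _ ◁ capPM _ ⊗≫ 𝟙 _)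
      (𝟙 _ ⊗≫ Qm _ ◁ cupPM _ ⊗≫ Qm _ ◁ dot _ ▷ Qm _ ⊗≫ capMP _ ▷ Qm _ ⊗≫ 𝟙 _)
  | cross_rotate : LocalRel lam (X := Qm _ ⊗ Qm _) (Y := Qm _ ⊗ Qm _)
      (𝟙 _ ⊗≫ cupMP _ ▷ (Qm _ ⊗ Qm _) ⊗≫ Qm _ ◁ crossRight _ ▷ Qm _ ⊗≫
        (Qm _ ⊗ Qm _) ◁ capPM _ ⊗≫ 𝟙 _)
      (𝟙 _ ⊗≫ (Qm _ ⊗ Qm _) ◁ cupPM _ ⊗≫ Qm _ ◁ crossLeft _ ▷ Qm _ ⊗≫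
        capMP _ ▷ (Qm _ ⊗ Qm _) ⊗≫ 𝟙 _)
  -- relations among upward strands
  | braid : LocalRel lam (X := Qp _ ⊗ Qp _ ⊗ Qp _) (Y := Qp _ ⊗ Qp _ ⊗ Qp _)
      (𝟙 _ ⊗≫ cross _ ▷ Qp _ ⊗≫ Qp _ ◁ cross _ ⊗≫ cross _ ▷ Qp _ ⊗≫ 𝟙 _)
      (𝟙 _ ⊗≫ Qp _ ◁ cross _ ⊗≫ cross _ ▷ Qp _ ⊗≫ Qp _ ◁ cross _ ⊗≫ 𝟙 _)
  | cross_sq : LocalRel lam (cross _ ≫ cross _) (𝟙 (Qp _ ⊗ Qp _))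
  | dot_slide₁ : LocalRel lam
      (dot _ ▷ Qp _ ≫ cross _ - cross _ ≫ Qp _ ◁ dot _) (𝟙 (Qp _ ⊗ Qp _))
  | dot_slide₂ : LocalRel lam
      (cross _ ≫ dot _ ▷ Qp _ - Qp _ ◁ dot _ ≫ cross _) (𝟙 (Qp _ ⊗ Qp _))
  -- relations between upward and downward strands
  | down_up : LocalRel lam (𝟙 (Qm _ ⊗ Qp _))
      (crossLeft _ ≫ crossRight _ + ∑ j ∈ Finset.range (level lam),
        (Qm _ ◁ dualDot _ (level lam) j ≫ capMP _) ≫ (cupMP _ ≫ Qm _ ◁ dots _ j))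
  | up_down : LocalRel lam (crossRight _ ≫ crossLeft _) (𝟙 (Qp _ ⊗ Qm _))
  -- counterclockwise circles and left curls
  | bubble_lt (j : ℕ) (hj : j + 1 < level lam) : LocalRel lam (bubble _ j) 0
  | bubble_one (j : ℕ) (hj : j + 1 = level lam) : LocalRel lam (bubble _ j) (𝟙 (𝟙_ (Free k)))
  | bubble_level : LocalRel lam (bubble _ (level lam))
      ((lam.sum fun i n => n • (i : k)) • 𝟙 (𝟙_ (Free k)))
  | left_curl : LocalRel lam (X := Qp _) (Y := Qp _)
      (𝟙 _ ⊗≫ cupMP _ ▷ Qp _ ⊗≫ Qm _ ◁ cross _ ⊗≫ capMP _ ▷ Qp _ ⊗≫ 𝟙 _) 0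

/-- The defining relations, as relations between formal linear combinations of diagrams. -/
def heisRel (lam : IntImage k →₀ ℕ) : PreRel k :=
  fun _ _ f g => LocalRel lam (Pres.hom (noRel k) f) (Pres.hom (noRel k) g)

/-- The strict `k`-linear monoidal category of the objects `Q_ε`, whose morphisms are linear
combinations of planar diagrams modulo isotopy and the local relations. -/
abbrev HeisWord (lam : IntImage k →₀ ℕ) : Type := Pres (heisRel lam)

/-- The additive category obtained by adjoining formal finite direct sums of the `Q_ε`. -/
abbrev HeisAdd (lam : IntImage k →₀ ℕ) : Type 1 := Mat_ (HeisWord lam)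

/-- The category `H^λ`: the idempotent completion of the additive category of diagrams. -/
abbrev HeisCat (lam : IntImage k →₀ ℕ) : Type (max 1 u) := Idempotents.Karoubi (HeisAdd lam)

/-! ### Functors -/

/-- A strict monoidal `k`-linear functor which is the identity on sign sequences. -/
structure DiagFunctor (L L' : PreRel k) where
  /-- the action on morphisms -/
  map {X Y : List Sign} : ((⟨X⟩ : Pres L) ⟶ ⟨Y⟩) →ₗ[k] ((⟨X⟩ : Pres L') ⟶ ⟨Y⟩)
  map_id (X : List Sign) : map (𝟙 (⟨X⟩ : Pres L)) = 𝟙 (⟨X⟩ : Pres L')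
  map_comp {X Y Z : List Sign} (f : (⟨X⟩ : Pres L) ⟶ ⟨Y⟩) (g : (⟨Y⟩ : Pres L) ⟶ ⟨Z⟩) :
    map (f ≫ g) = map f ≫ map g
  map_tensor {X Y X' Y' : List Sign} (f : (⟨X⟩ : Pres L) ⟶ ⟨Y⟩) (g : (⟨X'⟩ : Pres L) ⟶ ⟨Y'⟩) :
    map (X := X ++ X') (Y := Y ++ Y') (f ⊗ₘ g) = map f ⊗ₘ map g

namespace DiagFunctor

variable {L L' : PreRel k} (F : DiagFunctor L L')

/-- The underlying functor. -/
def functor : Pres L ⥤ Pres L' where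
  obj X := ⟨X.word⟩
  map {X Y} f := F.map (X := X.word) (Y := Y.word) f
  map_id X := F.map_id X.word
  map_comp f g := F.map_comp f g

instance : F.functor.Additive where
  map_add {X Y f g} := (F.map (X := X.word) (Y := Y.word)).map_add f g

/-- The induced functor between the idempotent completions of the additive envelopes. -/
def extend : Idempotents.Karoubi (Mat_ (Pres L)) ⥤ Idempotents.Karoubi (Mat_ (Pres L')) :=
  (Idempotents.functorExtension₂ _ _).obj F.functor.mapMat_

/-- The functor sends a dot to a dot minus `a` times the undotted strand, and leaves cups, caps
and crossings unchanged. -/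
structure IsDotShift (F : DiagFunctor L L') (a : k) : Prop where
  map_dot : F.map (dot L) = dot L' - a • 𝟙 (Qp L')
  map_cross : F.map (cross L) = cross L'
  map_cupMP : F.map (cupMP L) = cupMP L'
  map_capMP : F.map (capMP L) = capMP L'
  map_cupPM : F.map (cupPM L) = cupPM L'
  map_capPM : F.map (capPM L) = capPM L'

end DiagFunctor

theorem Rel.of_noRel {L : PreRel k} {X Y : List Sign} {f g : Raw k X Y} (h : Rel (noRel k) f g) :
    Rel L f g := by
  induction h with
  | of h => exact h.elim
  | refl f => exact .refl f
  | symm _ ih => exact .symm ih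
  | trans _ _ ih ih' => exact .trans ih ih'
  | comp _ _ ih ih' => exact .comp ih ih'
  | tensor _ _ ih ih' => exact .tensor ih ih'
  | add _ _ ih ih' => exact .add ih ih'
  | smul a _ ih => exact .smul a ih
  | id_comp f => exact .id_comp f
  | comp_id f => exact .comp_id f
  | assoc f g h => exact .assoc f g h
  | add_assoc f g h => exact .add_assoc f g h
  | add_comm f g => exact .add_comm f g
  | zero_add f => exact .zero_add f
  | smul_add a f g => exact .smul_add a f g
  | add_smul a b f => exact .add_smul a b f
  | mul_smul a b f => exact .mul_smul a b f
  | one_smul f => exact .one_smul f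
  | zero_smul f => exact .zero_smul f
  | add_comp f f' g => exact .add_comp f f' g
  | comp_add f g g' => exact .comp_add f g g'
  | smul_comp a f g => exact .smul_comp a f g
  | comp_smul a f g => exact .comp_smul a f g
  | add_tensor f f' g => exact .add_tensor f f' g
  | tensor_add f g g' => exact .tensor_add f g g'
  | smul_tensor a f g => exact .smul_tensor a f g
  | tensor_smul a f g => exact .tensor_smul a f g
  | id_tensor_id X Y => exact .id_tensor_id X Y
  | tensor_comp f g f' g' => exact .tensor_comp f g f' g'
  | id_tensor f => exact .id_tensor f
  | tensor_id f => exact .tensor_id f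
  | tensor_assoc f g h => exact .tensor_assoc f g h

/-- Passing from formal diagrams to their classes modulo isotopy and the local relations. -/
def classOf (lam : IntImage k →₀ ℕ) {X Y : List Sign} (f : (⟨X⟩ : Free k) ⟶ ⟨Y⟩) :
    (⟨X⟩ : HeisWord lam) ⟶ ⟨Y⟩ :=
  Quot.map id (fun _ _ h => h.of_noRel) f

end Heis

end

noncomputable section

namespace Heis

open Sign

variable {k : Type u} [CommRing k]

/-! ### Toeplitz determinants, divided differences and translations of polynomials -/

section Algebra

open Polynomial

variable {R : Type*} [CommRing R]

/-! Write a for the image of j in k. Relations without dots are fixed by the substitution; in the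
dot slides the terms a·s cancel, and the rotated dot is handled by linearity and the zigzags. What
remains are the circles and the dual-dot relation.

Let R = End(1), let D be the level (positive since the weight is nonzero), and let β be the R-linear
functional on R[X] with β(X^n) = b_n. It vanishes on X^n for n < D - 1 and equals 1 at n = D - 1.
Replacing x by x - a replaces β by q ↦ β(q(X - a)) (`translate_bubbleFunctional`). This keeps the
normalisation and subtracts Da from b_D, exactly the change of weight under translation
(`translate_succ`, `weight_translate`).

For the dual dots, let p have degree at most D, coefficient 1 at X^D, and be β-orthogonal to all
polynomials of degree < D. Inverting the series of moments shows that c_s is its coefficient at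
X^(D-s) (`toeplitz_eq_coeff`). The polynomial orthogonal for the translated functional is p(X + a),
so the substitution turns the c_s into the coefficients of p(X + a) (`exists_coeff_eq_toeplitz`).
The sum in the dual-dot relation is the divided difference (p(x) - p(y))/(x - y) applied to cap
followed by cup, with x and y the dot above the cup and below the cap (`dualDotSum_eq_divDiff`).
Passing to p(X + a), x - a, y - a leaves it unchanged (`divDiff_taylor`), so the sum is fixed.

The inverse comes from exchanging the weights and replacing j by -j. The two functors are inverse on
the nose, and so are their extensions. -/

/-- Coefficients of the inverse of a power series, as Toeplitz determinants. -/
theorem eq_det_of_convolution (h c : ℕ → R) (h0 : h 0 = 1) {s : ℕ}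
    (hc : ∀ n ≤ s, ∑ p ∈ Finset.HasAntidiagonal.antidiagonal n, h p.1 * c p.2 = if n = 0 then 1 else 0) :
    c s = (-1) ^ s * Matrix.det (Matrix.of fun i j : Fin s =>
      if (i : ℕ) ≤ j + 1 then h (j + 1 - i) else 0) := by
  -- A is multiplication by the series with coefficients h, modulo degree s + 1: unipotent lower
  -- triangular, and it sends c to the first basis vector.
  set A : Matrix (Fin (s + 1)) (Fin (s + 1)) R :=
    Matrix.of fun i j => if (j : ℕ) ≤ i then h (i - j) else 0 with hA
  have hdet : A.det = 1 := by
    rw [Matrix.det_of_isLowerTriangular A]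
    · simp [hA, h0]
    · intro i j hij
      have : ¬ j ≤ i := not_le.mpr hij
      simp [hA, this]
  have hmul : A.mulVec (fun j => c j) = Pi.single 0 1 := by
    ext i
    have hi := hc i (Nat.lt_succ_iff.mp i.2)
    rw [Finset.Nat.sum_antidiagonal_eq_sum_range_succ_mk, ← Finset.sum_range_reflect] at hi
    have : (A.mulVec fun j => c j) i = ∑ j ∈ Finset.range (s + 1),
        if j ≤ i then h (i - j) * c j else 0 := by
      simp [Matrix.mulVec, dotProduct, hA, ite_mul, Finset.sum_range]
    rw [this, ← Finset.sum_filter]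
    have hf : (Finset.range (s + 1)).filter (· ≤ (i : ℕ)) = Finset.range (i + 1) := by
      ext j; simp; omega
    rw [hf]
    trans (if (i : ℕ) = 0 then 1 else 0)
    · rw [← hi]
      refine Finset.sum_congr rfl fun j hj => ?_
      have := Finset.mem_range.mp hj
      congr 2; all_goals omega
    · by_cases hi0 : i = 0
      · simp [hi0]
      · simp [hi0]
  -- As det A = 1, the adjugate inverts A, so c s is its entry (s, 0): the signed minor of A without
  -- its first row and last column.
  have key : (A.adjugate.mulVec (A.mulVec fun j => c j)) (Fin.last s) = c s := by
    rw [Matrix.mulVec_mulVec, Matrix.adjugate_mul, hdet]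
    simp
  rw [← key, hmul, Matrix.mulVec_single_one, Matrix.col_apply,
    Matrix.adjugate_fin_succ_eq_det_submatrix, ← Matrix.det_transpose]
  simp [hA]
  rfl

/-- The coefficients `c_s` attached to a functional on polynomials, in place of the bubbles. -/
def toeplitz (β : R[X] →ₗ[R] R) (d s : ℕ) : R :=
  (-1) ^ s * Matrix.det (Matrix.of fun i j : Fin s => β (X ^ (d + (j : ℕ) - (i : ℕ))))

/-! ### Orthogonal polynomials and Toeplitz determinants -/

variable {β : R[X] →ₗ[R] R} {d : ℕ}

theorem functional_eq_sum (β : R[X] →ₗ[R] R) {p : R[X]} {n : ℕ} (hp : p.natDegree < n) :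
    β p = ∑ e ∈ Finset.range n, p.coeff e * β (X ^ e) := by
  conv_lhs => rw [p.as_sum_range' n hp, map_sum]
  refine Finset.sum_congr rfl fun e _ => ?_
  rw [← C_mul_X_pow_eq_monomial, ← smul_eq_C_mul, map_smul, smul_eq_mul]

/-- Moments below d vanish, so only the coefficients of p in degrees d - m, …, d + 1 contribute.
Read from the top, they form a convolution with the moments from d on, which turns orthogonality
into inversion of a power series. -/
theorem functional_mul_X_pow (hlt : ∀ n < d, β (X ^ n) = 0) {p : R[X]}
    (hp : p.natDegree ≤ d + 1) {m : ℕ} (hm : m ≤ d) :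
    β (p * X ^ m) = ∑ q ∈ Finset.HasAntidiagonal.antidiagonal (m + 1), β (X ^ (d + q.1)) * p.coeff (d + 1 - q.2) := by
  have e1 : β (p * X ^ m) = ∑ e ∈ Finset.range (d + 2), p.coeff e * β (X ^ (e + m)) := by
    conv_lhs => rw [p.as_sum_range' (d + 2) (by omega), Finset.sum_mul, map_sum]
    refine Finset.sum_congr rfl fun e _ => ?_
    rw [← C_mul_X_pow_eq_monomial, mul_assoc, ← pow_add, ← smul_eq_C_mul, map_smul, smul_eq_mul]
  rw [e1, ← Finset.sum_range_reflect, ← Finset.Nat.sum_antidiagonal_swap,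
    Finset.Nat.sum_antidiagonal_eq_sum_range_succ_mk]
  symm
  refine Finset.sum_subset_zero_on_sdiff (Finset.range_subset_range.mpr (by omega)) ?_ ?_
  · intro e he
    simp only [Finset.mem_sdiff, Finset.mem_range] at he
    rw [hlt _ (by omega), mul_zero]
  · intro e he
    have := Finset.mem_range.mp he
    simp only [Prod.fst_swap, Prod.snd_swap]
    rw [mul_comm]
    congr 3; all_goals omega

/-- Orthogonality makes the reversed coefficients of p the convolution inverse of the moments n ↦
β(X^(d+n)). The resulting determinant is the Toeplitz one because entries more than one step below
the diagonal are moments of index < d. -/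
theorem toeplitz_eq_coeff (hlt : ∀ n < d, β (X ^ n) = 0) (h1 : β (X ^ d) = 1) {p : R[X]}
    (hp : p.natDegree ≤ d + 1) (hp1 : p.coeff (d + 1) = 1) (hβ : ∀ m ≤ d, β (p * X ^ m) = 0)
    {s : ℕ} (hs : s ≤ d + 1) : p.coeff (d + 1 - s) = toeplitz β (d + 1) s := by
  rw [eq_det_of_convolution (fun n => β (X ^ (d + n))) (fun n => p.coeff (d + 1 - n)) h1, toeplitz]
  · congr 3
    ext i j
    split_ifs with h
    · congr 2; omega
    · rw [hlt _ (by omega)]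
  · rintro (_ | m) hm
    · simp [hp1, h1]
    · rw [if_neg (Nat.succ_ne_zero m), ← functional_mul_X_pow hlt hp (by omega), hβ m (by omega)]

/-- Take as coefficients of p, from the top down, those of the inverse of the series of moments from
d on. The degree is only bounded, because R may be the zero ring. -/
theorem exists_orthogonal (hlt : ∀ n < d, β (X ^ n) = 0) (h1 : β (X ^ d) = 1) :
    ∃ p : R[X], p.natDegree ≤ d + 1 ∧ p.coeff (d + 1) = 1 ∧ ∀ m ≤ d, β (p * X ^ m) = 0 := by
  set H : PowerSeries R := PowerSeries.mk fun n => β (X ^ (d + n)) with hH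
  set c : ℕ → R := fun n => PowerSeries.coeff n (H.invOfUnit 1) with hc
  have hHc : H * H.invOfUnit 1 = 1 := PowerSeries.mul_invOfUnit H 1 (by simp [hH, h1])
  set p : R[X] := ∑ e ∈ Finset.range (d + 2), monomial e (c (d + 1 - e)) with hpdef
  have hcoeff : ∀ e ≤ d + 1, p.coeff e = c (d + 1 - e) := by
    intro e he
    simp only [hpdef, finsetSum_coeff, coeff_monomial, Finset.sum_ite_eq', Finset.mem_range]
    rw [if_pos (by omega)]
  have hdeg : p.natDegree ≤ d + 1 := by
    refine natDegree_sum_le_of_forall_le _ _ fun e he => (natDegree_monomial_le _).trans ?_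
    have := Finset.mem_range.mp he
    omega
  refine ⟨p, hdeg, ?_, fun m hm => ?_⟩
  · rw [hcoeff _ le_rfl]
    simp [hc]
  · rw [functional_mul_X_pow hlt hdeg hm]
    have := congrArg (PowerSeries.coeff (m + 1)) hHc
    rw [PowerSeries.coeff_mul, PowerSeries.coeff_one, if_neg (Nat.succ_ne_zero m)] at this
    rw [← this]
    refine Finset.sum_congr rfl fun q hq => ?_
    have := Finset.HasAntidiagonal.mem_antidiagonal.mp hq
    rw [hcoeff _ (by omega), hH, PowerSeries.coeff_mk]
    congr 2
    omega

/-! ### Translation of functionals -/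

/-- The functional `p(X) ↦ β(p(X - a))`. -/
def translate (β : R[X] →ₗ[R] R) (a : R) : R[X] →ₗ[R] R := β ∘ₗ (taylor (-a) : R[X] →ₗ[R] R[X])

theorem translate_X_pow (β : R[X] →ₗ[R] R) (a : R) (n : ℕ) :
    translate β a (X ^ n) = β ((X - C a) ^ n) := by
  change β (taylor _ _) = _
  congr 1
  simp [sub_eq_add_neg]

theorem translate_X_pow_eq_sum (β : R[X] →ₗ[R] R) (a : R) (n : ℕ) :
    translate β a (X ^ n) =
      ∑ e ∈ Finset.range (n + 1), (-a) ^ (n - e) * (n.choose e : R) * β (X ^ e) := by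
  have hdeg : ((X - C a : R[X]) ^ n).natDegree < n + 1 := by
    rw [Nat.lt_succ_iff]
    refine natDegree_pow_le.trans ?_
    exact (Nat.mul_le_mul_left n (natDegree_X_sub_C_le a)).trans (mul_one n).le
  rw [translate_X_pow, functional_eq_sum β hdeg]
  simp only [sub_eq_add_neg, ← C_neg, coeff_X_add_C_pow]

theorem translate_eq_zero (hlt : ∀ n < d, β (X ^ n) = 0) (a : R) {n : ℕ} (hn : n < d) :
    translate β a (X ^ n) = 0 := by
  rw [translate_X_pow_eq_sum]
  refine Finset.sum_eq_zero fun e he => ?_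
  have := Finset.mem_range.mp he
  rw [hlt e (by omega), mul_zero]

theorem translate_eq_one (hlt : ∀ n < d, β (X ^ n) = 0) (h1 : β (X ^ d) = 1) (a : R) :
    translate β a (X ^ d) = 1 := by
  rw [translate_X_pow_eq_sum, Finset.sum_range_succ, Finset.sum_eq_zero]
  · simp [h1]
  · intro e he
    rw [hlt e (Finset.mem_range.mp he), mul_zero]

/-- Only the two top terms of (X - a)^(d+1) are seen by β; the binomial coefficient d + 1 is the
level. -/
theorem translate_succ (hlt : ∀ n < d, β (X ^ n) = 0) (h1 : β (X ^ d) = 1) (a : R) :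
    translate β a (X ^ (d + 1)) = β (X ^ (d + 1)) - (d + 1 : ℕ) * a := by
  rw [translate_X_pow_eq_sum, Finset.sum_range_succ, Finset.sum_range_succ, Finset.sum_eq_zero]
  · simp [h1]
    ring
  · intro e he
    rw [hlt e (Finset.mem_range.mp he), mul_zero]

/-- Translation carries the orthogonal polynomial p of β to p(X + a), since (p(X + a)q)(X - a) =
p·q(X - a) and q(X - a) has the same degree bound as q. -/
theorem exists_coeff_eq_toeplitz (hlt : ∀ n < d, β (X ^ n) = 0) (h1 : β (X ^ d) = 1) (a : R) :
    ∃ p : R[X], p.natDegree ≤ d + 1 ∧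
      (∀ s ≤ d + 1, p.coeff (d + 1 - s) = toeplitz β (d + 1) s) ∧
      ∀ s ≤ d + 1, (taylor a p).coeff (d + 1 - s) = toeplitz (translate β a) (d + 1) s := by
  obtain ⟨p, hdeg, hp1, hβ⟩ := exists_orthogonal hlt h1
  have key : ∀ q : R[X], q.natDegree ≤ d → β (p * q) = 0 := by
    intro q hq
    rw [q.as_sum_range' (d + 1) (by omega), Finset.mul_sum, map_sum]
    refine Finset.sum_eq_zero fun e he => ?_
    have := Finset.mem_range.mp he
    rw [← C_mul_X_pow_eq_monomial, ← smul_eq_C_mul, mul_smul_comm, map_smul, hβ e (by omega),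
      smul_zero]
  refine ⟨p, hdeg, fun s hs => toeplitz_eq_coeff hlt h1 hdeg hp1 hβ hs, fun s hs =>
    toeplitz_eq_coeff (fun n hn => translate_eq_zero hlt a hn) (translate_eq_one hlt h1 a)
      ((natDegree_taylor p a).trans_le hdeg) ?_ ?_ hs⟩
  -- If the degree drops, then 1 = 0 in R and there is nothing to prove; otherwise translation
  -- preserves the leading coefficient.
  · rcases hdeg.lt_or_eq with h | h
    · rw [coeff_eq_zero_of_natDegree_lt h] at hp1
      rw [← mul_one ((taylor a p).coeff _), ← hp1, mul_zero]
    · rw [← h, coeff_taylor_natDegree, ← hp1, ← h]; rfl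
  · intro m hm
    change β (taylor (-a) _) = 0
    rw [taylor_mul, taylor_taylor, neg_add_cancel, taylor_zero]
    refine key _ ?_
    rw [natDegree_taylor]
    exact (natDegree_X_pow_le m).trans hm

/-! ### Divided differences and their invariance under translation -/

/-- Truncated divided difference. -/
def divDiff {S : Type*} [Semiring S] (f : R →+* S) (x y : S) (p : R[X]) (d : ℕ) : S :=
  ∑ j ∈ Finset.range d, ∑ i ∈ Finset.Ico j d, f (p.coeff (i + 1)) * (y ^ (i - j) * x ^ j)

theorem map_divDiff {S T : Type*} [Semiring S] [Semiring T] (g : S →+* T) (f : R →+* S) (x y : S)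
    (p : R[X]) (d : ℕ) : g (divDiff f x y p d) = divDiff (g.comp f) (g x) (g y) p d := by
  simp [divDiff]

/-- After exchanging the sums, each coefficient multiplies a geometric sum, which telescopes; the
constant terms cancel. The degree bound ensures that truncation loses nothing. -/
theorem divDiff_mul_sub {S : Type*} [CommRing S] (f : R →+* S) (x y : S) (p : R[X]) {d : ℕ}
    (hp : p.natDegree ≤ d) : divDiff f x y p d * (x - y) = p.eval₂ f x - p.eval₂ f y := by
  have h : divDiff f x y p d = ∑ i ∈ Finset.range d, f (p.coeff (i + 1)) *
      ∑ j ∈ Finset.range (i + 1), x ^ j * y ^ (i + 1 - 1 - j) := by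
    simp only [divDiff, Finset.mul_sum]
    rw [Finset.sum_sigma', Finset.sum_sigma']
    refine Finset.sum_bij' (fun q _ => ⟨q.2, q.1⟩) (fun q _ => ⟨q.2, q.1⟩) ?_ ?_ ?_ ?_ ?_
    · simp; omega
    · simp; omega
    · simp
    · simp
    · intro q _; simp [mul_comm]
  rw [h, Finset.sum_mul]
  simp only [mul_assoc, geom_sum₂_mul]
  rw [eval₂_eq_sum_range' f (Nat.lt_succ_of_le hp), eval₂_eq_sum_range' f (Nat.lt_succ_of_le hp),
    ← Finset.sum_sub_distrib, Finset.sum_range_succ']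
  simp [mul_sub]

/-- Both sides times x - y equal p(x) - p(y), because (x - a) - (y - a) = x - y. -/
theorem divDiff_taylor_of_isRegular {S : Type*} [CommRing S] (f : R →+* S) {x y : S}
    (hxy : IsRegular (x - y)) (a : R) {p : R[X]} {d : ℕ} (hp : p.natDegree ≤ d) :
    divDiff f (x - f a) (y - f a) (taylor a p) d = divDiff f x y p d := by
  refine hxy.right.eq_iff.mp ?_
  have h := divDiff_mul_sub f (x - f a) (y - f a) (taylor a p) (d := d) (by rwa [natDegree_taylor])
  rw [sub_sub_sub_cancel_right] at h
  rw [h, divDiff_mul_sub f x y p hp, taylor_apply, eval₂_comp, eval₂_comp]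
  simp

theorem isRegular_sub_comm {S : Type*} [CommRing S] {x y : S} (h : IsRegular (x - y)) :
    IsRegular (y - x) := by
  have h1 : IsRegular (-1 : S) := (isUnit_one.neg).isRegular
  have h2 := h1.mul h
  rwa [neg_one_mul, neg_sub] at h2

theorem isRegular_C_X_sub_X : IsRegular (C X - X : R[X][X]) :=
  isRegular_sub_comm (monic_X_sub_C (X : R[X])).isRegular

/-- An identity with universal coefficients: it holds in R[X][X], where the difference of the
variables is regular, and specialises to any commuting x and y. A noncommutative target is needed
because S will be a ring of additive operators on a morphism group. -/
theorem divDiff_taylor {S : Type*} [Ring S] (f : R →+* S) (x y : S) (hx : ∀ r, Commute (f r) x)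
    (hy : ∀ r, Commute (f r) y) (hxy : Commute x y) (a : R) {p : R[X]} {d : ℕ}
    (hp : p.natDegree ≤ d) :
    divDiff f (x - f a) (y - f a) (taylor a p) d = divDiff f x y p d := by
  have huniv := divDiff_taylor_of_isRegular ((C : R[X] →+* R[X][X]).comp C) isRegular_C_X_sub_X a hp
  let g₁ : R[X] →+* S := eval₂RingHom' f x hx
  have hg₁ : ∀ q, Commute (g₁ q) y := by
    intro q
    induction q using Polynomial.induction_on' with
    | add p q hp hq => rw [map_add]; exact hp.add_left hq
    | monomial n r =>
      change Commute (eval₂ f x _) y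
      rw [eval₂_monomial]
      exact (hy r).mul_left (hxy.pow_left n)
  let g : R[X][X] →+* S := eval₂RingHom' g₁ y hg₁
  have h := congrArg g huniv
  have hgf : g.comp (C.comp C) = f := by
    ext r
    change eval₂ g₁ y (C (C r)) = f r
    rw [eval₂_C]
    exact eval₂_C _ _
  have hgx : g (C X) = x := (eval₂_C g₁ y).trans (eval₂_X f x)
  have hgy : g X = y := eval₂_X g₁ y
  have hga : g (((C : R[X] →+* R[X][X]).comp C) a) = f a := (eval₂_C g₁ y).trans (eval₂_C f x)
  rwa [map_divDiff, map_divDiff, map_sub, map_sub, hgf, hgx, hgy, hga] at h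

end Algebra

/-! ### The substitution on diagrams -/

/-- The substitution on elementary diagrams. -/
def Gen.shift (a : k) : ∀ {X Y : List Sign}, Gen X Y → Raw k X Y
  -- Negation of morphisms is multiplication by -1, so this nesting makes the class definitionally
  -- `dot L - a • 𝟙 (Qp L)`.
  | _, _, .dot => (Raw.gen .dot).add (((Raw.id [plus]).smul a).smul (-1))
  | _, _, .cross => .gen .cross
  | _, _, .cupMP => .gen .cupMP
  | _, _, .capMP => .gen .capMP
  | _, _, .cupPM => .gen .cupPM
  | _, _, .capPM => .gen .capPM

/-- The substitution on formal linear combinations of formal diagrams. -/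
def Raw.shift (a : k) : ∀ {X Y : List Sign}, Raw k X Y → Raw k X Y
  | _, _, .gen g => g.shift a
  | _, _, .id X => .id X
  | _, _, .comp f g => (f.shift a).comp (g.shift a)
  | _, _, .tensor f g => (f.shift a).tensor (g.shift a)
  | _, _, .zero X Y => .zero X Y
  | _, _, .add f g => (f.shift a).add (g.shift a)
  | _, _, .smul b f => (f.shift a).smul b

theorem Raw.shift_ofEq (a : k) {X Y : List Sign} (h : X = Y) :
    (Raw.ofEq h : Raw k X Y).shift a = Raw.ofEq h := by
  subst h; rfl

/-- The substitution is compatible with the relations once it sends the relations imposed on the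
source to relations which hold in the target. -/
theorem Rel.shift {L L' : PreRel k} (a : k)
    (hL : ∀ {X Y : List Sign} (f g : Raw k X Y), L f g → Rel L' (f.shift a) (g.shift a))
    {X Y : List Sign} {f g : Raw k X Y} (h : Rel L f g) : Rel L' (f.shift a) (g.shift a) := by
  induction h with
  | of h => exact hL _ _ h
  | refl f => exact .refl _
  | symm _ ih => exact .symm ih
  | trans _ _ ih ih' => exact .trans ih ih'
  | comp _ _ ih ih' => exact .comp ih ih'
  | tensor _ _ ih ih' => exact .tensor ih ih'
  | add _ _ ih ih' => exact .add ih ih'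
  | smul a _ ih => exact .smul a ih
  | id_comp f => exact .id_comp _
  | comp_id f => exact .comp_id _
  | assoc f g h => exact .assoc _ _ _
  | add_assoc f g h => exact .add_assoc _ _ _
  | add_comm f g => exact .add_comm _ _
  | zero_add f => exact .zero_add _
  | smul_add a f g => exact .smul_add a _ _
  | add_smul a b f => exact .add_smul a b _
  | mul_smul a b f => exact .mul_smul a b _
  | one_smul f => exact .one_smul _
  | zero_smul f => exact .zero_smul _
  | add_comp f f' g => exact .add_comp _ _ _
  | comp_add f g g' => exact .comp_add _ _ _
  | smul_comp a f g => exact .smul_comp a _ _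
  | comp_smul a f g => exact .comp_smul a _ _
  | add_tensor f f' g => exact .add_tensor _ _ _
  | tensor_add f g g' => exact .tensor_add _ _ _
  | smul_tensor a f g => exact .smul_tensor a _ _
  | tensor_smul a f g => exact .tensor_smul a _ _
  | id_tensor_id X Y => exact .id_tensor_id X Y
  | tensor_comp f g f' g' => exact .tensor_comp _ _ _ _
  | id_tensor f => exact .id_tensor _
  | tensor_id f =>
    simp only [Raw.shift, Raw.shift_ofEq]
    exact .tensor_id _
  | tensor_assoc f g h =>
    simp only [Raw.shift, Raw.shift_ofEq]
    exact .tensor_assoc _ _ _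

/-- Equality of classes is the relation generated by `L`. -/
theorem Pres.exact {L : PreRel k} {X Y : List Sign} {f g : Raw k X Y}
    (h : Pres.cls L f = Pres.cls L g) : Rel L f g := by
  have h' := Quot.eqvGen_exact h
  clear h
  induction h' with
  | rel _ _ h => exact h
  | refl => exact .refl _
  | symm _ _ _ ih => exact .symm ih
  | trans _ _ _ _ _ ih ih' => exact .trans ih ih'

/-- The functor given by the substitution `dot ↦ dot - a`. -/
def shiftFunctor {L L' : PreRel k} (a : k)
    (hL : ∀ {X Y : List Sign} (f g : Raw k X Y), L f g → Rel L' (f.shift a) (g.shift a)) :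
    DiagFunctor L L' where
  map :=
    { toFun := fun f => Quot.map (Raw.shift a) (fun _ _ h => Rel.shift a hL h) f
      map_add' := by rintro ⟨f⟩ ⟨g⟩; rfl
      map_smul' := by rintro b ⟨f⟩; rfl }
  map_id _ := rfl
  map_comp := by rintro _ _ _ ⟨f⟩ ⟨g⟩; rfl
  map_tensor := by rintro _ _ _ _ ⟨f⟩ ⟨g⟩; rfl

theorem isDotShift_shiftFunctor {L L' : PreRel k} (a : k)
    (hL : ∀ {X Y : List Sign} (f g : Raw k X Y), L f g → Rel L' (f.shift a) (g.shift a)) :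
    (shiftFunctor a hL).IsDotShift a where
  map_dot := rfl
  map_cross := rfl
  map_cupMP := rfl
  map_capMP := rfl
  map_cupPM := rfl
  map_capPM := rfl

theorem Raw.shift_shift_neg {L : PreRel k} (a b : k) (hab : a + b = 0) {X Y : List Sign}
    (f : Raw k X Y) : Rel L ((f.shift a).shift b) f := by
  induction f with
  | gen g =>
    cases g with
    | dot =>
      apply Pres.exact
      change (dot L - b • 𝟙 (Qp L)) - a • 𝟙 (Qp L) = dot L
      rw [sub_sub, ← add_smul, add_comm, hab, zero_smul, sub_zero]
    | _ => exact .refl _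
  | id | zero => exact .refl _
  | comp _ _ ih ih' => exact .comp ih ih'
  | tensor _ _ ih ih' => exact .tensor ih ih'
  | add _ _ ih ih' => exact .add ih ih'
  | smul _ _ ih => exact .smul _ ih

/-- The substitution on formal diagrams, read in the category with the relations `L`. -/
abbrev substitution (L : PreRel k) (a : k) : DiagFunctor (noRel k) L :=
  shiftFunctor a fun _ _ h => h.elim

theorem shiftFunctor_functor_comp {L L' : PreRel k} (a b : k) (hab : a + b = 0)
    (hL : ∀ {X Y : List Sign} (f g : Raw k X Y), L f g → Rel L' (f.shift a) (g.shift a))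
    (hL' : ∀ {X Y : List Sign} (f g : Raw k X Y), L' f g → Rel L (f.shift b) (g.shift b)) :
    (shiftFunctor a hL).functor ⋙ (shiftFunctor b hL').functor = 𝟭 (Pres L) := by
  refine Functor.hext (fun X => rfl) ?_
  rintro X Y ⟨f⟩
  exact heq_of_eq <| Pres.sound (Raw.shift_shift_neg a b hab f)

/-- Both envelopes preserve composites and identities strictly, so an equality of functors extends
to an equality. -/
theorem extend_comp_extend {L L' : PreRel k} (F : DiagFunctor L L') (G : DiagFunctor L' L)
    (h : F.functor ⋙ G.functor = 𝟭 (Pres L)) :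
    F.extend ⋙ G.extend = 𝟭 (Idempotents.Karoubi (Mat_ (Pres L))) := by
  -- The functor is generalised together with its additivity instance, so that the equation with the
  -- identity can be eliminated.
  have e : ∀ (H : Pres L ⥤ Pres L) [H.Additive], H = 𝟭 (Pres L) →
      (Idempotents.functorExtension₂ _ _).obj H.mapMat_ =
        𝟭 (Idempotents.Karoubi (Mat_ (Pres L))) := by
    rintro _ _ rfl; rfl
  exact (show _ = (Idempotents.functorExtension₂ _ _).obj (F.functor ⋙ G.functor).mapMat_ from
    rfl).trans (e _ h)

theorem classOf_eq_of_localRel (lam : IntImage k →₀ ℕ) {X Y : List Sign}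
    {f g : (⟨X⟩ : Free k) ⟶ ⟨Y⟩} (h : LocalRel lam f g) : classOf lam f = classOf lam g := by
  induction f using Quot.ind
  induction g using Quot.ind
  exact Pres.sound (.of h)

theorem classOf_shiftFunctor (lam : IntImage k →₀ ℕ) (a : k) {X Y : List Sign}
    (f : (⟨X⟩ : Free k) ⟶ ⟨Y⟩) :
    classOf lam ((substitution (noRel k) a).map f) = (substitution (heisRel lam) a).map f := by
  induction f using Quot.ind
  rfl

/-! ### The sum in the dual-dot relation -/

section DualDots

open Polynomial

attribute [local instance] endUnitCommRing

variable (L : PreRel k) {F : DiagFunctor (noRel k) L} {a : k}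

/-- The dot, as an element of the endomorphism ring of the upward strand. -/
def upDot : End (Qp L) := dot L

/-- The image of the dot under the substitution, as an element of the endomorphism ring. -/
def shiftedDot (a : k) : End (Qp L) := dot L - a • 𝟙 (Qp L)

theorem shiftedDot_eq (a : k) : shiftedDot L a = upDot L - algebraMap k (End (Qp L)) a := by
  rw [Algebra.algebraMap_eq_smul_one]; rfl

theorem dots_eq_pow (n : ℕ) : dots L n = upDot L ^ n := by
  induction n with
  | zero => rfl
  | succ n ih => rw [pow_succ', ← ih]; rfl

theorem DiagFunctor.IsDotShift.map_dots (hF : F.IsDotShift a) (n : ℕ) :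
    F.map (dots (noRel k) n) =
      shiftedDot L a ^ n := by
  induction n with
  | zero => exact F.map_id [plus]
  | succ n ih =>
    rw [pow_succ', ← ih]
    exact (F.map_comp _ _).trans (congrArg (F.map (dots (noRel k) n) ≫ ·) hF.map_dot)

/-- A counterclockwise circle, cut open on its upward strand. -/
def close (f : Qp L ⟶ Qp L) : End (𝟙_ (Pres L)) := cupMP L ≫ Qm L ◁ f ≫ capMP L

theorem close_add (f g : Qp L ⟶ Qp L) : close L (f + g) = close L f + close L g := by
  simp [close]

theorem close_smul (a : k) (f : Qp L ⟶ Qp L) : close L (a • f) = a • close L f := by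
  simp [close]

theorem DiagFunctor.IsDotShift.map_bubble (hF : F.IsDotShift a) (n : ℕ) :
    F.map (bubble (noRel k) n) = close L (shiftedDot L a ^ n) := by
  rw [← hF.map_dots L]
  refine (F.map_comp _ _).trans (congrArg₂ (· ≫ ·) hF.map_cupMP ?_)
  refine (F.map_comp _ _).trans (congrArg₂ (· ≫ ·) ?_ hF.map_capMP)
  exact (F.map_tensor _ _).trans (congrArg (· ⊗ₘ F.map _) (F.map_id [minus]))

/-- The functional whose moments are the counterclockwise circles. -/
def bubbleFunctional : (End (𝟙_ (Pres L)))[X] →ₗ[End (𝟙_ (Pres L))] End (𝟙_ (Pres L)) :=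
  (basisMonomials (End (𝟙_ (Pres L)))).constr (End (𝟙_ (Pres L))) fun n => bubble L n

theorem bubbleFunctional_X_pow (n : ℕ) : bubbleFunctional L (X ^ n) = bubble L n := by
  have := (basisMonomials (End (𝟙_ (Pres L)))).constr_basis (End (𝟙_ (Pres L)))
    (fun n => bubble L n) n
  rw [coe_basisMonomials] at this
  rw [← monomial_one_right_eq_X_pow]
  exact this

/-- Scalars of k pass through the cup and cap, so a circle carrying a polynomial in the dot is
evaluated by the functional. -/
theorem bubbleFunctional_map (p : k[X]) :
    bubbleFunctional L (p.map (algebraMap k (End (𝟙_ (Pres L))))) =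
      close L (aeval (upDot L) p) := by
  induction p using Polynomial.induction_on' with
  | add p q hp hq => rw [Polynomial.map_add, map_add, map_add, hp, hq]; exact (close_add L _ _).symm
  | monomial n r =>
    rw [map_monomial, ← C_mul_X_pow_eq_monomial, ← smul_eq_C_mul, map_smul, bubbleFunctional_X_pow,
      aeval_monomial, ← Algebra.smul_def, close_smul, ← dots_eq_pow, smul_eq_mul,
      ← Algebra.smul_def]
    rfl

theorem DiagFunctor.IsDotShift.translate_bubbleFunctional (hF : F.IsDotShift a) (n : ℕ) :
    translate (bubbleFunctional L) (algebraMap k _ a) (X ^ n) = F.map (bubble (noRel k) n) := by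
  have h := bubbleFunctional_map L ((X - C a) ^ n)
  simp only [Polynomial.map_pow, Polynomial.map_sub, map_X, map_C, map_pow, map_sub, aeval_X,
    aeval_C] at h
  rw [hF.map_bubble, shiftedDot_eq, ← h]
  exact translate_X_pow _ _ _

theorem cc_eq_toeplitz (d s : ℕ) : cc L d s = toeplitz (bubbleFunctional L) d s := by
  simp only [toeplitz, bubbleFunctional_X_pow]
  rfl

/-- The action of a functor on closed diagrams. -/
def endUnitMap (F : DiagFunctor (noRel k) L) : End (𝟙_ (Free k)) →+* End (𝟙_ (Pres L)) where
  toFun f := F.map (X := []) (Y := []) f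
  map_one' := F.map_id []
  map_mul' f g := F.map_comp (X := []) (Y := []) (Z := []) g f
  map_zero' := map_zero _
  map_add' := map_add _

/-- On closed diagrams the functor is a ring homomorphism, hence commutes with the determinant, and
its values on circles are the translated moments. -/
theorem DiagFunctor.IsDotShift.map_cc (hF : F.IsDotShift a) (d s : ℕ) :
    F.map (cc (noRel k) d s) =
      toeplitz (translate (bubbleFunctional L) (algebraMap k _ a)) d s := by
  change endUnitMap L F (_ * _) = _
  rw [map_mul, map_pow, map_neg, map_one, RingHom.map_det, toeplitz]
  congr 2
  ext i j
  exact (hF.translate_bubbleFunctional L _).symm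

/-! ### Diagrams as operators on the endomorphisms of Q₋Q₊ -/

/-- A closed diagram placed to the right of an upward strand. -/
def besideStrand : End (𝟙_ (Pres L)) →+* End (Qp L) where
  toFun r := (ρ_ (Qp L)).inv ≫ Qp L ◁ r ≫ (ρ_ (Qp L)).hom
  map_one' := by
    change (ρ_ (Qp L)).inv ≫ Qp L ◁ 𝟙 _ ≫ (ρ_ (Qp L)).hom = 𝟙 _
    simp
  map_mul' r s := by
    change (ρ_ (Qp L)).inv ≫ Qp L ◁ (s ≫ r) ≫ (ρ_ (Qp L)).hom =
      ((ρ_ (Qp L)).inv ≫ Qp L ◁ s ≫ (ρ_ (Qp L)).hom) ≫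
        ((ρ_ (Qp L)).inv ≫ Qp L ◁ r ≫ (ρ_ (Qp L)).hom)
    simp
  map_zero' := by
    change (ρ_ (Qp L)).inv ≫ Qp L ◁ (0 : 𝟙_ (Pres L) ⟶ _) ≫ (ρ_ (Qp L)).hom = 0
    simp
  map_add' := by
    intro (r : 𝟙_ (Pres L) ⟶ 𝟙_ (Pres L)) (s : 𝟙_ (Pres L) ⟶ 𝟙_ (Pres L))
    change (ρ_ (Qp L)).inv ≫ Qp L ◁ (r + s) ≫ (ρ_ (Qp L)).hom =
      (ρ_ (Qp L)).inv ≫ Qp L ◁ r ≫ (ρ_ (Qp L)).hom + (ρ_ (Qp L)).inv ≫ Qp L ◁ s ≫ (ρ_ (Qp L)).hom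
    simp

/-- This is the interchange law: the closed diagram slides vertically past f. -/
theorem commute_besideStrand (r : End (𝟙_ (Pres L))) (f : End (Qp L)) :
    Commute (besideStrand L r) f := by
  change f ≫ (ρ_ (Qp L)).inv ≫ Qp L ◁ r ≫ (ρ_ (Qp L)).hom =
    ((ρ_ (Qp L)).inv ≫ Qp L ◁ r ≫ (ρ_ (Qp L)).hom) ≫ f
  rw [rightUnitor_inv_naturality_assoc, ← whisker_exchange_assoc]
  simp

theorem besideStrand_algebraMap (a : k) :
    besideStrand L (algebraMap k _ a) = algebraMap k _ a := by
  rw [Algebra.algebraMap_eq_smul_one, Algebra.algebraMap_eq_smul_one]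
  change (ρ_ (Qp L)).inv ≫ Qp L ◁ (a • 𝟙 _) ≫ (ρ_ (Qp L)).hom = a • 𝟙 _
  simp

/-- Precomposition with an endomorphism of the upward strand. -/
def precomp : (End (Qp L))ᵐᵒᵖ →+* AddMonoid.End (Qm L ⊗ Qp L ⟶ Qm L ⊗ Qp L) where
  toFun f := AddMonoidHom.mk' (fun m => Qm L ◁ f.unop ≫ m) (by simp)
  map_one' := by
    ext m
    change Qm L ◁ 𝟙 _ ≫ m = m
    simp
  map_mul' f g := by
    ext m
    change Qm L ◁ (f.unop ≫ g.unop) ≫ m = Qm L ◁ f.unop ≫ Qm L ◁ g.unop ≫ m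
    simp
  map_zero' := by
    ext m
    change Qm L ◁ (0 : Qp L ⟶ Qp L) ≫ m = 0
    simp
  map_add' f g := by
    ext m
    have h : ∀ f g : Qp L ⟶ Qp L, Qm L ◁ (f + g) ≫ m = Qm L ◁ f ≫ m + Qm L ◁ g ≫ m := by simp
    exact h f.unop g.unop

/-- Postcomposition with an endomorphism of the upward strand. -/
def postcomp : End (Qp L) →+* AddMonoid.End (Qm L ⊗ Qp L ⟶ Qm L ⊗ Qp L) where
  toFun f := AddMonoidHom.mk' (fun m => m ≫ Qm L ◁ f) (by simp)
  map_one' := by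
    ext m
    change m ≫ Qm L ◁ 𝟙 _ = m
    simp
  map_mul' f g := by
    ext m
    change m ≫ Qm L ◁ (g ≫ f) = (m ≫ Qm L ◁ g) ≫ Qm L ◁ f
    simp
  map_zero' := by
    ext m
    change m ≫ Qm L ◁ (0 : Qp L ⟶ Qp L) = 0
    simp
  map_add' f g := by
    ext m
    have h : ∀ f g : Qp L ⟶ Qp L, m ≫ Qm L ◁ (f + g) = m ≫ Qm L ◁ f + m ≫ Qm L ◁ g := by simp
    exact h f g

theorem commute_precomp_postcomp (f : (End (Qp L))ᵐᵒᵖ) (g : End (Qp L)) :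
    Commute (precomp L f) (postcomp L g) := by
  ext m
  change Qm L ◁ f.unop ≫ m ≫ Qm L ◁ g = (Qm L ◁ f.unop ≫ m) ≫ Qm L ◁ g
  simp

/-- Precomposition with a closed diagram placed to the right of the upward strand. -/
def precompClosed :
    End (𝟙_ (Pres L)) →+* AddMonoid.End (Qm L ⊗ Qp L ⟶ Qm L ⊗ Qp L) :=
  (precomp L).comp ((besideStrand L).toOpposite fun _ _ => (commute_besideStrand L _ _))

/-- The sum in the dual-dot relation, for an endomorphism `e` of the strand in place of the dot and
closed diagrams `c s` in place of `c_s`. -/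
def dualDotSum (e : End (Qp L)) (c : ℕ → End (𝟙_ (Pres L))) (d : ℕ) :
    Qm L ⊗ Qp L ⟶ Qm L ⊗ Qp L :=
  ∑ j ∈ Finset.range d, (Qm L ◁ (∑ i ∈ Finset.Ico j d, (ρ_ (Qp L)).inv ≫
    ((e ^ (i - j) : End (Qp L)) ⊗ₘ c (d - 1 - i)) ≫ (ρ_ (Qp L)).hom) ≫ capMP L) ≫
      (cupMP L ≫ Qm L ◁ (e ^ j : End (Qp L)))

theorem dualDotSum_eq_divDiff (e : End (Qp L)) (c : ℕ → End (𝟙_ (Pres L))) (d : ℕ)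
    (p : (End (𝟙_ (Pres L)))[X]) (hp : ∀ s ≤ d, p.coeff (d - s) = c s) :
    dualDotSum L e c d = divDiff (precompClosed L) (postcomp L e) (precomp L (.op e)) p d
      (capMP L ≫ cupMP L) := by
  have happ : ∀ (t : Finset ℕ) (f : ℕ → AddMonoid.End (Qm L ⊗ Qp L ⟶ Qm L ⊗ Qp L))
      (m : Qm L ⊗ Qp L ⟶ Qm L ⊗ Qp L), (∑ i ∈ t, f i) m = ∑ i ∈ t, f i m :=
    fun t f m => map_sum (AddMonoidHom.eval m) f t
  rw [divDiff, dualDotSum, happ]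
  refine Finset.sum_congr rfl fun j _ => ?_
  rw [happ, whiskerLeft_sum, Preadditive.sum_comp, Preadditive.sum_comp]
  refine Finset.sum_congr rfl fun i hi => ?_
  have hi := Finset.mem_Ico.mp hi
  -- The closed factor with index d - 1 - i is the coefficient of X^(i+1), which is the shift built
  -- into `divDiff`.
  rw [← map_pow, ← map_pow, ← hp (d - 1 - i) (by omega), show d - (d - 1 - i) = i + 1 by omega,
    ← MulOpposite.op_pow]
  change _ = Qm L ◁ ((ρ_ (Qp L)).inv ≫ Qp L ◁ p.coeff (i + 1) ≫ (ρ_ (Qp L)).hom) ≫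
    Qm L ◁ (e ^ (i - j) : End (Qp L)) ≫ (capMP L ≫ cupMP L) ≫ Qm L ◁ (e ^ j : End (Qp L))
  rw [MonoidalCategory.tensorHom_def']
  simp

/-- The shifted circles give the coefficients of p(X + a), and the dots at both ends become the dot
minus a. A scalar acts alike as a closed diagram, by precomposition and by postcomposition, so this
is a simultaneous translation that the divided difference ignores. -/
theorem DiagFunctor.IsDotShift.dualDotSum_eq (hF : F.IsDotShift a) {d : ℕ}
    (hlt : ∀ n < d, bubble L n = 0) (h1 : bubble L d = 𝟙 _) :
    dualDotSum L (shiftedDot L a) (fun s => F.map (cc (noRel k) (d + 1) s)) (d + 1) =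
      dualDotSum L (upDot L) (cc L (d + 1)) (d + 1) := by
  obtain ⟨p, hdeg, hp, hp'⟩ := exists_coeff_eq_toeplitz (β := bubbleFunctional L) (d := d)
    (fun n hn => (bubbleFunctional_X_pow L n).trans (hlt n hn))
    ((bubbleFunctional_X_pow L d).trans h1) (algebraMap k _ a)
  rw [dualDotSum_eq_divDiff L _ _ _ (taylor (algebraMap k _ a) p)
      fun s hs => (hp' s hs).trans (hF.map_cc L _ s).symm,
    dualDotSum_eq_divDiff L _ _ _ p fun s hs => (hp s hs).trans (cc_eq_toeplitz L _ s).symm,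
    ← divDiff_taylor (precompClosed L) (postcomp L (upDot L)) (precomp L (.op (upDot L))) ?_ ?_ ?_
      (algebraMap k _ a) hdeg]
  · have e1 : precompClosed L (algebraMap k _ a) = precomp L (.op (algebraMap k _ a)) :=
      congrArg (fun f => precomp L (.op f)) (besideStrand_algebraMap L a)
    have e2 : precomp L (.op (algebraMap k _ a)) = postcomp L (algebraMap k _ a) := by
      ext m
      rw [Algebra.algebraMap_eq_smul_one]
      change Qm L ◁ (a • 𝟙 (Qp L)) ≫ m = m ≫ Qm L ◁ (a • 𝟙 (Qp L))
      simp
    congr 2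
    · rw [e1, e2, ← map_sub]; rfl
    · rw [e1, ← map_sub]; rfl
  · intro r
    exact commute_precomp_postcomp L _ _
  · intro r
    refine Commute.map (f := precomp L) ?_
    exact (commute_besideStrand L r (upDot L)).op
  · exact (commute_precomp_postcomp L _ _).symm

theorem DiagFunctor.IsDotShift.map_dualDot (hF : F.IsDotShift a) (d j : ℕ) :
    F.map (dualDot (noRel k) d j) =
      ∑ i ∈ Finset.Ico j d, (ρ_ (Qp L)).inv ≫ ((shiftedDot L a ^ (i - j) : End (Qp L)) ⊗ₘ
          F.map (cc (noRel k) d (d - 1 - i))) ≫ (ρ_ (Qp L)).hom := by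
  refine (map_sum (F.map (X := [plus]) (Y := [plus])) _ _).trans
    (Finset.sum_congr rfl fun i _ => ?_)
  refine (F.map_comp _ _).trans (congrArg₂ (· ≫ ·) (F.map_id [plus]) ?_)
  refine (F.map_comp _ _).trans (congrArg₂ (· ≫ ·) ?_ (F.map_id [plus]))
  rw [← hF.map_dots L]
  exact F.map_tensor _ _

theorem DiagFunctor.IsDotShift.map_dualDotSum (hF : F.IsDotShift a) (d : ℕ) :
    F.map (∑ j ∈ Finset.range d, (Qm _ ◁ dualDot (noRel k) d j ≫ capMP _) ≫
        (cupMP _ ≫ Qm _ ◁ dots _ j)) =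
      dualDotSum L (shiftedDot L a) (fun s => F.map (cc (noRel k) d s)) d := by
  refine (map_sum (F.map (X := [minus, plus]) (Y := [minus, plus])) _ _).trans
    (Finset.sum_congr rfl fun j _ => ?_)
  rw [← hF.map_dots L, ← hF.map_dualDot L]
  refine (F.map_comp _ _).trans (congrArg₂ (· ≫ ·) ?_ ?_)
  · refine (F.map_comp _ _).trans (congrArg₂ (· ≫ ·) ?_ hF.map_capMP)
    exact (F.map_tensor _ _).trans (congrArg (· ⊗ₘ F.map _) (F.map_id [minus]))
  · refine (F.map_comp _ _).trans (congrArg₂ (· ≫ ·) hF.map_cupMP ?_)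
    exact (F.map_tensor _ _).trans (congrArg (· ⊗ₘ F.map _) (F.map_id [minus]))

end DualDots

/-! ### Translation of the weight -/

theorem sum_translate {M : Type*} [AddCommMonoid M] {lam mu : IntImage k →₀ ℕ} {j : IntImage k}
    (hmu : ∀ i, mu i = lam (i - j)) (f : IntImage k → ℕ → M) :
    mu.sum f = lam.sum fun i n => f (i + j) n := by
  have : mu = Finsupp.equivMapDomain (Equiv.addRight j) lam := by
    ext i
    rw [hmu, Finsupp.equivMapDomain_apply]
    simp [sub_eq_add_neg]
  rw [this, Finsupp.sum_equivMapDomain]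
  rfl

theorem level_translate {lam mu : IntImage k →₀ ℕ} {j : IntImage k}
    (hmu : ∀ i, mu i = lam (i - j)) : level mu = level lam :=
  sum_translate hmu _

theorem weight_translate {lam mu : IntImage k →₀ ℕ} {j : IntImage k}
    (hmu : ∀ i, mu i = lam (i - j)) :
    (mu.sum fun i n => n • (i : k)) = (lam.sum fun i n => n • (i : k)) + level lam • (j : k) := by
  rw [sum_translate hmu, level, Finsupp.sum, Finsupp.sum, Finsupp.sum, Finset.sum_smul,
    ← Finset.sum_add_distrib]
  exact Finset.sum_congr rfl fun i _ => by rw [Subring.coe_add, smul_add]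

theorem level_pos {lam : IntImage k →₀ ℕ} (h : lam ≠ 0) : 0 < level lam := by
  obtain ⟨i, hi⟩ := Finsupp.ne_iff.mp h
  have hi : lam i ≠ 0 := hi
  exact (Nat.pos_of_ne_zero hi).trans_le
    (Finset.single_le_sum (f := lam) (fun _ _ => Nat.zero_le _) (Finsupp.mem_support_iff.mpr hi))

/-! ### Local relations in the quotient -/

/-- The quotient functor. -/
def quotientFunctor (lam : IntImage k →₀ ℕ) : DiagFunctor (noRel k) (heisRel lam) where
  map :=
    { toFun := fun f => classOf lam f
      map_add' := by rintro ⟨f⟩ ⟨g⟩; rfl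
      map_smul' := by rintro b ⟨f⟩; rfl }
  map_id _ := rfl
  map_comp := by rintro _ _ _ ⟨f⟩ ⟨g⟩; rfl
  map_tensor := by rintro _ _ _ _ ⟨f⟩ ⟨g⟩; rfl

/-- Taking classes is the shift by 0, so the results on shifts also compute the classes of circles
and of the dual-dot sum. -/
theorem isDotShift_quotientFunctor (lam : IntImage k →₀ ℕ) :
    (quotientFunctor lam).IsDotShift 0 where
  map_dot := by rw [zero_smul, sub_zero]; rfl
  map_cross := rfl
  map_cupMP := rfl
  map_capMP := rfl
  map_cupPM := rfl
  map_capPM := rfl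

section Relations

open Polynomial

attribute [local instance] endUnitCommRing

variable (lam : IntImage k →₀ ℕ)

theorem classOf_bubble (n : ℕ) : classOf lam (bubble (noRel k) n) = bubble (heisRel lam) n := by
  refine ((isDotShift_quotientFunctor lam).map_bubble _ n).trans ?_
  have h : shiftedDot (heisRel lam) (0 : k) = upDot (heisRel lam) := by
    rw [shiftedDot_eq, map_zero, sub_zero]
  rw [h, ← dots_eq_pow]
  rfl

variable {d : ℕ} (hd : level lam = d + 1)

include hd

theorem bubble_eq_zero {n : ℕ} (hn : n < d) : bubble (heisRel lam) n = 0 :=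
  (classOf_bubble lam n).symm.trans <| classOf_eq_of_localRel lam (.bubble_lt n (by omega))

theorem bubble_eq_one : bubble (heisRel lam) d = 𝟙 _ :=
  (classOf_bubble lam d).symm.trans <| classOf_eq_of_localRel lam (.bubble_one d hd.symm)

theorem bubble_succ_eq : bubble (heisRel lam) (d + 1) =
    (lam.sum fun i n => n • (i : k)) • 𝟙 (𝟙_ (HeisWord lam)) := by
  rw [← hd, ← classOf_bubble]
  exact classOf_eq_of_localRel lam .bubble_level

theorem bubbleFunctional_eq_zero (n : ℕ) (hn : n < d) :
    bubbleFunctional (heisRel lam) (X ^ n) = 0 :=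
  (bubbleFunctional_X_pow _ n).trans (bubble_eq_zero lam hd hn)

theorem bubbleFunctional_eq_one : bubbleFunctional (heisRel lam) (X ^ d) = 1 :=
  (bubbleFunctional_X_pow _ d).trans (bubble_eq_one lam hd)

variable {F : DiagFunctor (noRel k) (heisRel lam)} {a : k} (hF : F.IsDotShift a)

include hF

theorem DiagFunctor.IsDotShift.map_bubble_eq_zero {n : ℕ} (hn : n < d) :
    F.map (bubble (noRel k) n) = 0 := by
  rw [← hF.translate_bubbleFunctional]
  exact translate_eq_zero (bubbleFunctional_eq_zero lam hd) _ hn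

theorem DiagFunctor.IsDotShift.map_bubble_eq_one :
    F.map (bubble (noRel k) d) = 𝟙 (𝟙_ (HeisWord lam)) := by
  rw [← hF.translate_bubbleFunctional]
  exact translate_eq_one (bubbleFunctional_eq_zero lam hd) (bubbleFunctional_eq_one lam hd) _

theorem DiagFunctor.IsDotShift.map_bubble_succ :
    F.map (bubble (noRel k) (d + 1)) =
      ((lam.sum fun i n => n • (i : k)) - (d + 1 : ℕ) • a) • 𝟙 (𝟙_ (HeisWord lam)) := by
  rw [← hF.translate_bubbleFunctional]
  refine (translate_succ (bubbleFunctional_eq_zero lam hd) (bubbleFunctional_eq_one lam hd)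
    _).trans ?_
  rw [bubbleFunctional_X_pow, bubble_succ_eq lam hd, sub_smul, ← nsmul_eq_mul, ← map_nsmul,
    Algebra.algebraMap_eq_smul_one]
  rfl

theorem DiagFunctor.IsDotShift.map_dualDotSum_eq :
    F.map (∑ j ∈ Finset.range (level lam), (Qm _ ◁ dualDot (noRel k) (level lam) j ≫ capMP _) ≫
        (cupMP _ ≫ Qm _ ◁ dots _ j)) =
      dualDotSum (heisRel lam) (upDot _) (cc _ (level lam)) (level lam) := by
  rw [hF.map_dualDotSum]
  rw [hd]
  exact hF.dualDotSum_eq _ (fun n hn => bubble_eq_zero lam hd hn) (bubble_eq_one lam hd)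

end Relations

/-! ### Linearity of whiskering and of rotated strands -/

theorem whiskerLeft_sub_smul {L : PreRel k} (Z : Pres L) {X Y : Pres L} (f g : X ⟶ Y) (a : k) :
    Z ◁ (f - a • g) = Z ◁ f - a • Z ◁ g := by
  rw [sub_eq_add_neg, ← neg_smul, MonoidalPreadditive.whiskerLeft_add,
    MonoidalLinear.whiskerLeft_smul, neg_smul, sub_eq_add_neg]

theorem sub_smul_whiskerRight {L : PreRel k} {X Y : Pres L} (f g : X ⟶ Y) (a : k) (Z : Pres L) :
    (f - a • g) ▷ Z = f ▷ Z - a • g ▷ Z := by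
  rw [sub_eq_add_neg, ← neg_smul, MonoidalPreadditive.add_whiskerRight,
    MonoidalLinear.smul_whiskerRight, neg_smul, sub_eq_add_neg]

section Rotation

variable (L : PreRel k)

/-- The rotation by two right angles of an endomorphism of the upward strand, with the cup on the
left. -/
def rotateLeft (f : Qp L ⟶ Qp L) : Qm L ⟶ Qm L :=
  𝟙 _ ⊗≫ cupMP L ▷ Qm L ⊗≫ Qm L ◁ f ▷ Qm L ⊗≫ Qm L ◁ capPM L ⊗≫ 𝟙 _

/-- The rotation by two right angles of an endomorphism of the upward strand, with the cup on the
right. -/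
def rotateRight (f : Qp L ⟶ Qp L) : Qm L ⟶ Qm L :=
  𝟙 _ ⊗≫ Qm L ◁ cupPM L ⊗≫ Qm L ◁ f ▷ Qm L ⊗≫ capMP L ▷ Qm L ⊗≫ 𝟙 _

theorem rotateLeft_sub_smul (a : k) (f g : Qp L ⟶ Qp L) :
    rotateLeft L (f - a • g) = rotateLeft L f - a • rotateLeft L g := by
  simp [rotateLeft, monoidalComp, whiskerLeft_sub_smul, sub_smul_whiskerRight]

theorem rotateRight_sub_smul (a : k) (f g : Qp L ⟶ Qp L) :
    rotateRight L (f - a • g) = rotateRight L f - a • rotateRight L g := by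
  simp [rotateRight, monoidalComp, whiskerLeft_sub_smul, sub_smul_whiskerRight]

theorem rotateLeft_id : rotateLeft L (𝟙 _) =
    𝟙 _ ⊗≫ cupMP L ▷ Qm L ⊗≫ Qm L ◁ capPM L ⊗≫ 𝟙 _ := by
  simp [rotateLeft, monoidalComp]

theorem rotateRight_id : rotateRight L (𝟙 _) =
    𝟙 _ ⊗≫ Qm L ◁ cupPM L ⊗≫ capMP L ▷ Qm L ⊗≫ 𝟙 _ := by
  simp [rotateRight, monoidalComp]

end Rotation

/-! ### Verification of the defining relations -/

/-- The substitution carries the defining relations for a weight to relations which hold for the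
translated weight. -/
theorem substitution_eq_of_localRel {lam mu : IntImage k →₀ ℕ} {j : IntImage k} (hlam : lam ≠ 0)
    (hmu : ∀ i, mu i = lam (i - j)) {X Y : Free k} {f g : X ⟶ Y} (h : LocalRel lam f g) :
    (substitution (heisRel mu) (j : k)).functor.map f =
      (substitution (heisRel mu) (j : k)).functor.map g := by
  have hlev := level_translate hmu
  -- The level is written d + 1, so that d indexes the circle equal to 1.
  obtain ⟨d, hd⟩ := Nat.exists_eq_add_one_of_ne_zero (level_pos hlam).ne'
  have hS := isDotShift_shiftFunctor (L := noRel k) (L' := heisRel mu) (j : k)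
    fun _ _ h => h.elim
  cases h with
  -- No dot occurs here, so the substitution and the class map agree definitionally; likewise in the
  -- other dot-free cases.
  | zigzag₁ => exact (classOf_eq_of_localRel mu .zigzag₁ :)
  | zigzag₂ => exact (classOf_eq_of_localRel mu .zigzag₂ :)
  | zigzag₃ => exact (classOf_eq_of_localRel mu .zigzag₃ :)
  | zigzag₄ => exact (classOf_eq_of_localRel mu .zigzag₄ :)
  -- Rotation is linear, and the zigzag relations straighten both rotations of the undotted strand
  -- to the identity.
  | dot_rotate =>
    have h : rotateLeft (heisRel mu) (dot _) = rotateRight _ (dot _) :=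
      classOf_eq_of_localRel mu .dot_rotate
    have h₁ : rotateLeft (heisRel mu) (𝟙 _) = 𝟙 _ :=
      (rotateLeft_id _).trans (classOf_eq_of_localRel mu .zigzag₃ :)
    have h₂ : rotateRight (heisRel mu) (𝟙 _) = 𝟙 _ :=
      (rotateRight_id _).trans (classOf_eq_of_localRel mu .zigzag₄ :)
    change rotateLeft (heisRel mu) (dot _ - (j : k) • 𝟙 _) =
      rotateRight (heisRel mu) (dot _ - (j : k) • 𝟙 _)
    rw [rotateLeft_sub_smul, rotateRight_sub_smul, h, h₁, h₂]
  | cross_rotate => exact (classOf_eq_of_localRel mu .cross_rotate :)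
  | braid => exact (classOf_eq_of_localRel mu .braid :)
  | cross_sq => exact (classOf_eq_of_localRel mu .cross_sq :)
  | dot_slide₁ =>
    have h : dot (heisRel mu) ▷ Qp _ ≫ cross _ - cross _ ≫ Qp _ ◁ dot _ = 𝟙 _ :=
      classOf_eq_of_localRel mu .dot_slide₁
    refine Eq.trans (b := (dot (heisRel mu) - (j : k) • 𝟙 (Qp _)) ▷ Qp _ ≫ cross _ -
      cross _ ≫ Qp _ ◁ (dot _ - (j : k) • 𝟙 (Qp _))) rfl (Eq.trans ?_ h)
    simp [whiskerLeft_sub_smul, sub_smul_whiskerRight]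
    -- Both terms have acquired the same multiple of the crossing.
    exact sub_sub_sub_cancel_right _ _ _
  | dot_slide₂ =>
    have h : cross (heisRel mu) ≫ dot _ ▷ Qp _ - Qp _ ◁ dot _ ≫ cross _ = 𝟙 _ :=
      classOf_eq_of_localRel mu .dot_slide₂
    refine Eq.trans (b := cross (heisRel mu) ≫ (dot (heisRel mu) - (j : k) • 𝟙 (Qp _)) ▷ Qp _ -
      Qp _ ◁ (dot _ - (j : k) • 𝟙 (Qp _)) ≫ cross _) rfl (Eq.trans ?_ h)
    simp [whiskerLeft_sub_smul, sub_smul_whiskerRight]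
    exact sub_sub_sub_cancel_right _ _ _
  | down_up =>
    have h := classOf_eq_of_localRel mu .down_up
    -- The dual-dot sum has the same image under the shift by 0 and the shift by j, so the relation
    -- for the second weight, which has the same level, gives the claim.
    have h' : classOf mu (∑ j ∈ Finset.range (level mu),
        (Qm _ ◁ dualDot (noRel k) (level mu) j ≫ capMP _) ≫ (cupMP _ ≫ Qm _ ◁ dots _ j)) = _ :=
      (isDotShift_quotientFunctor mu).map_dualDotSum_eq mu (hlev.trans hd)
    have h2 := hS.map_dualDotSum_eq mu (hlev.trans hd)
    rw [← h'] at h2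
    rw [← hlev]
    refine (h.trans ?_ :)
    refine ((quotientFunctor mu).map.map_add _ _).trans ?_
    refine Eq.trans ?_ (((substitution (heisRel mu) (j : k)).map).map_add _ _).symm
    exact congrArg₂ (· + ·) rfl h2.symm
  | up_down => exact (classOf_eq_of_localRel mu .up_down :)
  | bubble_lt n hn =>
    exact (hS.map_bubble_eq_zero mu (hlev.trans hd) (by omega)).trans
      ((substitution (heisRel mu) (j : k)).map.map_zero).symm
  | bubble_one n hn =>
    obtain rfl : n = d := by omega
    exact hS.map_bubble_eq_one mu (hlev.trans hd)
  | bubble_level =>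
    rw [hd]
    refine (hS.map_bubble_succ mu (hlev.trans hd)).trans ?_
    -- The weight sum of `mu` exceeds that of `lam` by level times j, which is what the shifted
    -- circle loses.
    rw [weight_translate hmu, hd, add_sub_cancel_right]
    exact (((substitution (heisRel mu) (j : k)).map (X := []) (Y := [])).map_smul _ (𝟙 (𝟙_ (Free k)))).symm
  | left_curl => exact (classOf_eq_of_localRel mu .left_curl :)

end Heis
end

/-! ### The isomorphism of categories -/

theorem mainTheorem8 {k : Type u} [CommRing k] (lam : Heis.IntImage k →₀ ℕ) (hlam : lam ≠ 0)
    (j : Heis.IntImage k) (mu : Heis.IntImage k →₀ ℕ) (hmu : ∀ i, mu i = lam (i - j)) :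
    ∃ (Φ : Heis.DiagFunctor (Heis.noRel k) (Heis.noRel k))
      (Ψ : Heis.DiagFunctor (Heis.heisRel lam) (Heis.heisRel mu)),
      -- the substitution on diagrams: dot ↦ dot - j, cups, caps and crossings fixed
      Φ.IsDotShift (j : k) ∧
      -- it preserves every defining relation
      (∀ {X Y : List Heis.Sign} (f g : (⟨X⟩ : Heis.Free k) ⟶ ⟨Y⟩), Heis.LocalRel lam f g →
        Heis.classOf mu (Φ.map f) = Heis.classOf mu (Φ.map g)) ∧
      -- hence it induces a functor between the diagram categories, given by the same formulas
      (∀ {X Y : List Heis.Sign} (f : (⟨X⟩ : Heis.Free k) ⟶ ⟨Y⟩),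
        Ψ.map (Heis.classOf lam f) = Heis.classOf mu (Φ.map f)) ∧
      Ψ.IsDotShift (j : k) ∧
      -- whose extension to `H^λ` is an isomorphism of categories
      ∃ G : Heis.HeisCat mu ⥤ Heis.HeisCat lam,
        Ψ.extend ⋙ G = 𝟭 (Heis.HeisCat lam) ∧ G ⋙ Ψ.extend = 𝟭 (Heis.HeisCat mu) := by
  -- The hypotheses are symmetric under exchanging the weights and negating j; this provides the
  -- inverse functor.
  have hmu' : ∀ i, lam i = mu (i - -j) := fun i => by rw [hmu, sub_neg_eq_add, add_sub_cancel_right]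
  have hmu0 : mu ≠ 0 := by
    rintro rfl
    exact hlam (Finsupp.ext fun i => hmu' i)
  have hL : ∀ {X Y : List Heis.Sign} (f g : Heis.Raw k X Y), Heis.heisRel lam f g →
      Heis.Rel (Heis.heisRel mu) (f.shift (j : k)) (g.shift (j : k)) := fun f g h =>
    Heis.Pres.exact (Heis.substitution_eq_of_localRel hlam hmu h)
  have hL' : ∀ {X Y : List Heis.Sign} (f g : Heis.Raw k X Y), Heis.heisRel mu f g →
      Heis.Rel (Heis.heisRel lam) (f.shift ((-j : Heis.IntImage k) : k))
        (g.shift ((-j : Heis.IntImage k) : k)) := fun f g h =>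
    Heis.Pres.exact (Heis.substitution_eq_of_localRel hmu0 hmu' h)
  have hj : (j : k) + ((-j : Heis.IntImage k) : k) = 0 := by simp
  refine ⟨Heis.substitution (Heis.noRel k) (j : k), Heis.shiftFunctor j hL,
    Heis.isDotShift_shiftFunctor _ fun _ _ h => h.elim, fun f g h => ?_, fun f => ?_,
    Heis.isDotShift_shiftFunctor _ hL, (Heis.shiftFunctor _ hL').extend, ?_, ?_⟩
  · rw [Heis.classOf_shiftFunctor, Heis.classOf_shiftFunctor]
    exact Heis.substitution_eq_of_localRel hlam hmu h
  · induction f using Quot.ind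
    rfl
  · exact Heis.extend_comp_extend _ _ (Heis.shiftFunctor_functor_comp _ _ hj hL hL')
  · exact Heis.extend_comp_extend _ _
      (Heis.shiftFunctor_functor_comp _ _ ((add_comm _ _).trans hj) hL' hL)
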